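/- Throughout, $\mathbb N=\{1,2,3,\dots\}$ and $[t]$ is the integer part of $t$. Let $0<L_1<L$ and let $(P_\pm)$ be the problem of finding pairs $(\omega,u)$, $\omega<0$, $u$ real-valued, with $$-u''-u^3=\omega u,\qquad u\in H^2_{per}([0,L]),\qquad u(0)=\pm u(L_1)=\sqrt{2|\omega|},$$ where $H^2_{per}([0,L])=\{u\in H^2([0,L]):u(0)=u(L),\ u'(0)=u'(L)\}$. Let $\mathrm{cn}(\cdot\,;k)$ be the Jacobi elliptic cosine of modulus $k$, let $K(k)=\int_0^1\frac{dt}{\sqrt{(1-t^2)(1-k^2t^2)}}$, and for $k\in(1/\sqrt2,1)$ put $$S(k)=4\sqrt{2k^2-1}\,K(k),\qquad H(k)=\int_{\sqrt{(2k^2-1)/k^2}}^1\frac{dt}{\sqrt{(1-t^2)(1-k^2(1-t^2))}},\qquad \varphi(k)=\frac{H(k)}{K(k)}.$$ $S$ is an increasing bijection of $(1/\sqrt2,1)$ onto $(0,\infty)$ and $\varphi$ a decreasing bijection of $(1/\sqrt2,1)$ onto $(0,1)$; let $G=S\circ\varphi^{-1}$. For $n\in\mathbb N$ and $\omega<0$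 let $k_{n,\omega}=S^{-1}(L\sqrt{|\omega|}/n)$, $$c_{n,\omega}(x)=\sqrt{\tfrac{2|\omega|k_{n,\omega}^2}{2k_{n,\omega}^2-1}}\ \mathrm{cn}\Big(\sqrt{\tfrac{|\omega|}{2k_{n,\omega}^2-1}}\,x\,;k_{n,\omega}\Big),\qquad \gamma_{n,\omega}=\sqrt{\tfrac{2k_{n,\omega}^2-1}{|\omega|}}\,H(k_{n,\omega}),\qquad \tilde u^\pm_{n,\omega}(x)=c_{n,\omega}(x\pm\gamma_{n,\omega}).$$ For $n\in\mathbb N$ let $r_n=\frac{L_1}{L}n-\big[\frac{L_1}{L}n+\frac12\big]$, $\xi_n=2|r_n|$, $s_n^+=\frac{L}{2n}r_n$, $s_n^-=\frac{L}{2n}\big(|r_n|-\frac12\big)\,\mathrm{sgn}(r_n)$. When $\xi_n\in(0,1)$, let $\omega_n^\pm<0$ be given by $$\sqrt{|\omega_n^+|}=\frac nL\,G(\xi_n),\qquad \sqrt{|\omega_n^-|}=\frac nL\,G(1-\xi_n),\qquad\text{and}\quad u_n^\pm(x)=c_{n,\omega_n^\pm}(x-s_n^\pm).$$ Theorem. Suppose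 $L_1/L=p/q$ with $p,q\in\mathbb N$ coprime. The set of all solutions of $(P_+)$ is $$\{(\omega,\tilde u^\pm_{n,\omega}):\omega<0,\ n\in\mathbb N q\}\ \cup\ \{(\omega_n^+,u_n^+):n\in\mathbb N,\ n\notin\mathbb N q,\ np/q+1/2\notin\mathbb N\}.$$ The set of all solutions of $(P_-)$ is $$\{(\omega_n^-,u_n^-):n\in\mathbb N,\ n\notin\mathbb N q\}\quad\text{if } q \text{ is odd},$$ $$\{(\omega,\tilde u^\pm_{n,\omega}):\omega<0,\ n\in(2\mathbb N-1)q/2\}\ \cup\ \{(\omega_n^-,u_n^-):n\in\mathbb N,\ n\notin\mathbb N q/2\}\quad\text{if } q \text{ is even}.$$ -/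

import Mathlib

open Set MeasureTheory

noncomputable section

namespace DoubleBridge

/-! ### Jacobi elliptic functions and elliptic integrals (modulus `k`) -/

/-- Incomplete elliptic integral of the first kind
`F(φ; k) = ∫₀^φ dθ / √(1 - k² sin² θ)`. -/
def ellF (k φ : ℝ) : ℝ := ∫ θ in (0 : ℝ)..φ, 1 / √(1 - k ^ 2 * Real.sin θ ^ 2)

/-- Jacobi amplitude: the inverse of the bijection `φ ↦ F(φ; k)` of `ℝ` (for `0 ≤ k < 1`). -/
def jacobiAm (y k : ℝ) : ℝ := Function.invFun (ellF k) y

/-- Jacobi elliptic cosine `cn(y; k) = cos (am (y; k))`. -/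
def jacobiCn (y k : ℝ) : ℝ := Real.cos (jacobiAm y k)

/-- Complete elliptic integral of the first kind. -/
def ellK (k : ℝ) : ℝ := ∫ t in (0 : ℝ)..1, 1 / √((1 - t ^ 2) * (1 - k ^ 2 * t ^ 2))

/-- The range of the modulus, `(1/√2, 1)`. -/
def modulusRange : Set ℝ := Ioo (1 / √2) 1

/-- `S(k) = 4 √(2k² - 1) K(k)`, an increasing bijection of `(1/√2, 1)` onto `(0, ∞)`. -/
def S (k : ℝ) : ℝ := 4 * √(2 * k ^ 2 - 1) * ellK k

/-- The inverse of `S : (1/√2, 1) → (0, ∞)`. -/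
def SInv (y : ℝ) : ℝ := Function.invFunOn S modulusRange y

/-- `∫_{√((2k²-1)/k²)}^1 dt / √((1 - t²)(1 - k²(1 - t²)))`. -/
def shiftIntegral (k : ℝ) : ℝ :=
  ∫ t in (√((2 * k ^ 2 - 1) / k ^ 2))..1, 1 / √((1 - t ^ 2) * (1 - k ^ 2 * (1 - t ^ 2)))

/-- `φ(k)`, a decreasing bijection of `(1/√2, 1)` onto `(0, 1)`. -/
def phi (k : ℝ) : ℝ := shiftIntegral k / ellK k

/-- The inverse of `φ : (1/√2, 1) → (0, 1)`. -/
def phiInv (y : ℝ) : ℝ := Function.invFunOn phi modulusRange y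

/-- `G = S ∘ φ⁻¹ : (0, 1) → (0, ∞)`. -/
def G (y : ℝ) : ℝ := S (phiInv y)

/-! ### The boundary value problems -/

/-- `v` is the weak derivative of `u` on `(0, L)`. -/
def IsWeakDeriv (L : ℝ) (u v : ℝ → ℝ) : Prop :=
  ∀ η : ℝ → ℝ, ContDiff ℝ (⊤ : ℕ∞) η → HasCompactSupport η → tsupport η ⊆ Ioo 0 L →
    ∫ x in Ioo 0 L, u x * deriv η x = -∫ x in Ioo 0 L, v x * η x

/-- `u ∈ H²(0, L)` with weak derivatives `u' = v` and `u'' = w`. -/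
structure IsH2With (L : ℝ) (u v w : ℝ → ℝ) : Prop where
  memLp : MemLp u 2 (volume.restrict (Ioo 0 L))
  memLp_fst : MemLp v 2 (volume.restrict (Ioo 0 L))
  memLp_snd : MemLp w 2 (volume.restrict (Ioo 0 L))
  weakDeriv_fst : IsWeakDeriv L u v
  weakDeriv_snd : IsWeakDeriv L v w

/-- `u` is (the continuous representative of) an element of
`H²_per([0, L]) = {u ∈ H²([0, L]) : u(0) = u(L), u'(0) = u'(L)}`.
Such a `u` is `C¹` on `[0, L]`, so that the one-sided derivatives at the end points are genuine.
Only the values of `u` on `[0, L]` matter. -/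
structure IsH2Per (L : ℝ) (u : ℝ → ℝ) : Prop where
  continuousOn : ContinuousOn u (Icc 0 L)
  exists_weak : ∃ v w, IsH2With L u v w
  periodic : u 0 = u L
  periodic_deriv : derivWithin u (Icc 0 L) 0 = derivWithin u (Icc 0 L) L

/-- `-u'' - u³ = ω u` on `(0, L)` for `u ∈ H²(0, L)`. -/
def SolvesNLS (L ω : ℝ) (u : ℝ → ℝ) : Prop :=
  ∃ v w, IsH2With L u v w ∧ ∀ᵐ x ∂(volume.restrict (Ioo 0 L)), -w x - u x ^ 3 = ω * u x

/-- The problem `-u'' - u³ = ω u`, `u ∈ H²_per([0, L])`, `ω < 0`,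
`u(0) = ε u(L₁) = √(2|ω|)`, where `ε = 1` for `(P₊)` and `ε = -1` for `(P₋)`. -/
structure SolvesP (ε L L₁ ω : ℝ) (u : ℝ → ℝ) : Prop where
  neg : ω < 0
  mem : IsH2Per L u
  eqn : SolvesNLS L ω u
  left : u 0 = √(2 * |ω|)
  right : ε * u L₁ = √(2 * |ω|)

/-- A function on `[0, L]` obtained by restriction. -/
def onInterval (L : ℝ) (u : ℝ → ℝ) : Icc (0 : ℝ) L → ℝ := fun x => u x

/-- The set of all solutions `(ω, u)`, `u` a function on `[0, L]`, of `(P₊)`. -/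
def solutionsPplus (L L₁ : ℝ) : Set (ℝ × (Icc (0 : ℝ) L → ℝ)) :=
  {z | ∃ ω u, SolvesP 1 L L₁ ω u ∧ z = (ω, onInterval L u)}

/-- The set of all solutions `(ω, u)`, `u` a function on `[0, L]`, of `(P₋)`. -/
def solutionsPminus (L L₁ : ℝ) : Set (ℝ × (Icc (0 : ℝ) L → ℝ)) :=
  {z | ∃ ω u, SolvesP (-1) L L₁ ω u ∧ z = (ω, onInterval L u)}

/-! ### The explicit solutions -/

/-- `k_{n,ω} = S⁻¹(L √|ω| / n)`. -/
def kMod (L : ℝ) (n : ℕ) (ω : ℝ) : ℝ := SInv (L * √|ω| / n)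

/-- The cnoidal function of period `L / n` and frequency `ω`,
`√(2|ω|k²/(2k²-1)) cn(√(|ω|/(2k²-1)) x; k)` with `k = k_{n,ω}`. -/
def cnoidal (L : ℝ) (n : ℕ) (ω x : ℝ) : ℝ :=
  √(2 * |ω| * kMod L n ω ^ 2 / (2 * kMod L n ω ^ 2 - 1)) *
    jacobiCn (√(|ω| / (2 * kMod L n ω ^ 2 - 1)) * x) (kMod L n ω)

/-- The shift `γ_{n,ω}`. -/
def gammaShift (L : ℝ) (n : ℕ) (ω : ℝ) : ℝ :=
  √((2 * kMod L n ω ^ 2 - 1) / |ω|) * shiftIntegral (kMod L n ω)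

/-- The branch functions `ũ⁺_{n,ω}`. -/
def uTildePlus (L : ℝ) (n : ℕ) (ω x : ℝ) : ℝ := cnoidal L n ω (x + gammaShift L n ω)

/-- The branch functions `ũ⁻_{n,ω}`. -/
def uTildeMinus (L : ℝ) (n : ℕ) (ω x : ℝ) : ℝ := cnoidal L n ω (x - gammaShift L n ω)

/-- `r_n = (L₁/L) n - ⌊(L₁/L) n + 1/2⌋`. -/
def rSeq (L L₁ : ℝ) (n : ℕ) : ℝ := L₁ / L * n - ⌊L₁ / L * n + 1 / 2⌋

/-- `ξ_n = 2 |r_n|`. -/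
def xiSeq (L L₁ : ℝ) (n : ℕ) : ℝ := 2 * |rSeq L L₁ n|

/-- `ω_n⁺ < 0` with `√|ω_n⁺| = (n/L) G(ξ_n)`. -/
def omegaPlus (L L₁ : ℝ) (n : ℕ) : ℝ := -((n / L * G (xiSeq L L₁ n)) ^ 2)

/-- `ω_n⁻ < 0` with `√|ω_n⁻| = (n/L) G(1 - ξ_n)`. -/
def omegaMinus (L L₁ : ℝ) (n : ℕ) : ℝ := -((n / L * G (1 - xiSeq L L₁ n)) ^ 2)

/-- `s_n⁺ = (L/2n) r_n`. -/
def sPlus (L L₁ : ℝ) (n : ℕ) : ℝ := L / (2 * n) * rSeq L L₁ n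

/-- `s_n⁻ = (L/2n) (|r_n| - 1/2) sgn r_n`. -/
def sMinus (L L₁ : ℝ) (n : ℕ) : ℝ :=
  L / (2 * n) * (|rSeq L L₁ n| - 1 / 2) * Real.sign (rSeq L L₁ n)

/-- `u_n⁺`. -/
def uPlus (L L₁ : ℝ) (n : ℕ) (x : ℝ) : ℝ :=
  cnoidal L n (omegaPlus L L₁ n) (x - sPlus L L₁ n)

/-- `u_n⁻`. -/
def uMinus (L L₁ : ℝ) (n : ℕ) (x : ℝ) : ℝ :=
  cnoidal L n (omegaMinus L L₁ n) (x - sMinus L L₁ n)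

/-! ### Index sets; here `ℕ` in the mathematical notation means the positive integers -/

/-- The `n ≥ 1` with `n ∈ ℕ c`. -/
def multiples (c : ℝ) : Set ℕ := {n | 1 ≤ n ∧ ∃ m : ℕ, 1 ≤ m ∧ (n : ℝ) = m * c}

/-- The `n ≥ 1` with `n ∈ (2ℕ - 1) c`. -/
def oddMultiples (c : ℝ) : Set ℕ := {n | 1 ≤ n ∧ ∃ m : ℕ, 1 ≤ m ∧ (n : ℝ) = (2 * m - 1) * c}

/-- `{(ω, ũ^±_{n,ω}) : ω < 0, n ∈ A}`. -/
def branches (L : ℝ) (A : Set ℕ) : Set (ℝ × (Icc (0 : ℝ) L → ℝ)) :=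
  {z | ∃ n ∈ A, ∃ ω : ℝ, ω < 0 ∧
    (z = (ω, onInterval L (uTildePlus L n ω)) ∨ z = (ω, onInterval L (uTildeMinus L n ω)))}

/-- `{(ω_n⁺, u_n⁺) : n ∈ A}`. -/
def isolatedPlus (L L₁ : ℝ) (A : Set ℕ) : Set (ℝ × (Icc (0 : ℝ) L → ℝ)) :=
  {z | ∃ n ∈ A, z = (omegaPlus L L₁ n, onInterval L (uPlus L L₁ n))}

/-- `{(ω_n⁻, u_n⁻) : n ∈ A}`. -/
def isolatedMinus (L L₁ : ℝ) (A : Set ℕ) : Set (ℝ × (Icc (0 : ℝ) L → ℝ)) :=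
  {z | ∃ n ∈ A, z = (omegaMinus L L₁ n, onInterval L (uMinus L L₁ n))}

end DoubleBridge

end

open DoubleBridge

/-! The height `√(2|ω|)` is the maximum of the homoclinic orbit `√(2|ω|) sech(√|ω| x)` of
`-u'' - u³ = ω u` in the phase plane. A periodic solution through that height therefore has nonzero
slope there, and each nonzero slope lies on exactly one of the sign-changing closed orbits, which
are the cnoidal waves with modulus `k ∈ (1/√2, 1)`. Periodicity makes `L` an `n`-fold multiple of
the period, so that `k = S⁻¹(L √|ω| / n)`, and `u(0) = √(2|ω|)` leaves the two phases
`t = ± φ(k) / 2`, measured in half periods.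

With a half period added for `(P₋)`, the condition at `L₁` asks the wave to take the same value at
two points. As a cnoidal wave takes each value exactly twice per period, up to sign, this is a
congruence: either `n L₁/L (+ 1/2)` is an integer, and every `ω < 0` is admissible, or
`n L₁/L (+ 1/2) + t` is an integer, and `φ(k) = 2|t|` determines `k`, hence `ω`.
-/

namespace DoubleBridge

open Real Filter Topology

/-! ### The incomplete elliptic integral and the amplitude -/

section Amplitude

variable {k : ℝ}

theorem one_sub_sq_mul_sin_sq_pos (hk : k ^ 2 < 1) (θ : ℝ) : 0 < 1 - k ^ 2 * sin θ ^ 2 := by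
  nlinarith [sin_sq_le_one θ, sq_nonneg k, sq_nonneg (sin θ)]

theorem continuous_ellF_integrand (hk : k ^ 2 < 1) :
    Continuous fun θ : ℝ => 1 / √(1 - k ^ 2 * sin θ ^ 2) :=
  Continuous.div (by fun_prop) (by fun_prop)
    fun θ => (sqrt_pos.2 (one_sub_sq_mul_sin_sq_pos hk θ)).ne'

theorem one_le_ellF_integrand (hk : k ^ 2 < 1) (θ : ℝ) : 1 ≤ 1 / √(1 - k ^ 2 * sin θ ^ 2) := by
  rw [le_div_iff₀ (sqrt_pos.2 (one_sub_sq_mul_sin_sq_pos hk θ)), one_mul, sqrt_le_one]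
  linarith [mul_nonneg (sq_nonneg k) (sq_nonneg (sin θ))]

theorem hasDerivAt_ellF (hk : k ^ 2 < 1) (θ : ℝ) :
    HasDerivAt (ellF k) (1 / √(1 - k ^ 2 * sin θ ^ 2)) θ :=
  (continuous_ellF_integrand hk).integral_hasStrictDerivAt 0 θ |>.hasDerivAt

theorem continuous_ellF (hk : k ^ 2 < 1) : Continuous (ellF k) :=
  continuous_iff_continuousAt.2 fun θ => (hasDerivAt_ellF hk θ).continuousAt

theorem strictMono_ellF (hk : k ^ 2 < 1) : StrictMono (ellF k) :=
  strictMono_of_deriv_pos fun θ => by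
    rw [(hasDerivAt_ellF hk θ).deriv]
    exact one_pos.trans_le (one_le_ellF_integrand hk θ)

@[simp] theorem ellF_zero : ellF k 0 = 0 := by simp [ellF]

theorem ellF_neg (θ : ℝ) : ellF k (-θ) = -ellF k θ := by
  have h := intervalIntegral.integral_comp_neg (a := 0) (b := θ)
    fun θ : ℝ => 1 / √(1 - k ^ 2 * sin θ ^ 2)
  simp only [sin_neg, neg_sq, neg_zero] at h
  rw [ellF, ellF, intervalIntegral.integral_symm, ← h]

theorem le_ellF (hk : k ^ 2 < 1) {θ : ℝ} (hθ : 0 ≤ θ) : θ ≤ ellF k θ := by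
  have h := intervalIntegral.integral_mono_on hθ
    (intervalIntegrable_const (μ := volume) (c := (1 : ℝ)))
    ((continuous_ellF_integrand hk).intervalIntegrable 0 θ)
    fun x _ => one_le_ellF_integrand hk x
  simpa [ellF] using h

theorem surjective_ellF (hk : k ^ 2 < 1) : Function.Surjective (ellF k) := by
  refine (continuous_ellF hk).surjective ?_ ?_
  · exact tendsto_atTop_mono' _
      ((eventually_ge_atTop 0).mono fun θ hθ => le_ellF hk hθ) tendsto_id
  · refine tendsto_atBot_mono' _ ((eventually_le_atBot 0).mono fun θ hθ => ?_) tendsto_id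
    simpa [ellF_neg] using le_ellF hk (neg_nonneg.2 hθ)

theorem integral_eq_sub_of_hasDerivAt_of_nonneg {f f' : ℝ → ℝ} {a b : ℝ} (hab : a ≤ b)
    (hf : ContinuousOn f (Icc a b)) (hderiv : ∀ x ∈ Ioo a b, HasDerivAt f (f' x) x)
    (hnonneg : ∀ x ∈ Ioo a b, 0 ≤ f' x) : ∫ x in a..b, f' x = f b - f a :=
  intervalIntegral.integral_eq_sub_of_hasDerivAt_of_le hab hf hderiv <|
    intervalIntegral.intervalIntegrable_deriv_of_nonneg (by rwa [uIcc_of_le hab])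
      (by rwa [min_eq_left hab, max_eq_right hab]) (by rwa [min_eq_left hab, max_eq_right hab])

theorem integral_eq_ellF_arcsin (hk : k ^ 2 < 1) {s : ℝ} (h0 : 0 ≤ s) (h1 : s ≤ 1) :
    ∫ t in (0 : ℝ)..s, 1 / √((1 - t ^ 2) * (1 - k ^ 2 * t ^ 2)) = ellF k (arcsin s) := by
  have hderiv : ∀ t ∈ Ioo 0 s, HasDerivAt (fun t => ellF k (arcsin t))
      (1 / √((1 - t ^ 2) * (1 - k ^ 2 * t ^ 2))) t := fun t ⟨ht0, hts⟩ => by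
    refine ((hasDerivAt_ellF hk (arcsin t)).comp t
      (hasDerivAt_arcsin (by linarith) (by linarith))).congr_deriv ?_
    rw [sin_arcsin (by linarith) (by linarith), sqrt_mul (by nlinarith), one_div_mul_one_div,
      mul_comm]
  rw [integral_eq_sub_of_hasDerivAt_of_nonneg h0
    ((continuous_ellF hk).comp continuous_arcsin).continuousOn hderiv fun t _ => by positivity]
  simp

theorem ellK_eq_ellF (hk : k ^ 2 < 1) : ellK k = ellF k (π / 2) := by
  rw [ellK, integral_eq_ellF_arcsin hk zero_le_one le_rfl, arcsin_one]

theorem integral_eq_ellF_arccos (hk : k ^ 2 < 1) {c : ℝ} (h0 : 0 ≤ c) (h1 : c ≤ 1) :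
    ∫ t in c..1, 1 / √((1 - t ^ 2) * (1 - k ^ 2 * (1 - t ^ 2))) = ellF k (arccos c) := by
  have hderiv : ∀ t ∈ Ioo c 1, HasDerivAt (fun t => -ellF k (arccos t))
      (1 / √((1 - t ^ 2) * (1 - k ^ 2 * (1 - t ^ 2)))) t := fun t ⟨hct, ht1⟩ => by
    have ht : 0 ≤ 1 - t ^ 2 := by nlinarith
    refine ((hasDerivAt_ellF hk (arccos t)).comp t
      (hasDerivAt_arccos (by linarith) ht1.ne)).neg.congr_deriv ?_
    rw [sin_arccos, sq_sqrt ht, sqrt_mul ht, mul_neg, neg_neg, one_div_mul_one_div, mul_comm]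
  rw [integral_eq_sub_of_hasDerivAt_of_nonneg h1
    ((continuous_ellF hk).comp continuous_arccos).neg.continuousOn hderiv
    fun t _ => by positivity]
  simp

theorem ellF_add_pi (hk : k ^ 2 < 1) (θ : ℝ) : ellF k (θ + π) = ellF k θ + 2 * ellK k := by
  have hint := fun a b => (continuous_ellF_integrand hk).intervalIntegrable (μ := volume) a b
  have hper : Function.Periodic (fun θ : ℝ => 1 / √(1 - k ^ 2 * sin θ ^ 2)) π :=
    fun θ => by simp [sin_add_pi]
  calc ellF k (θ + π)
      = ellF k θ + ∫ x in θ..θ + π, 1 / √(1 - k ^ 2 * sin x ^ 2) :=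
        (intervalIntegral.integral_add_adjacent_intervals (hint 0 θ) (hint θ (θ + π))).symm
    _ = ellF k θ + ∫ x in -(π / 2)..-(π / 2) + π, 1 / √(1 - k ^ 2 * sin x ^ 2) := by
        rw [hper.intervalIntegral_add_eq]
    _ = ellF k θ + (ellF k (π / 2) - ellF k (-(π / 2))) := by
        rw [show -(π / 2) + π = π / 2 by ring, ellF, ellF, ellF,
          intervalIntegral.integral_interval_sub_left (hint _ _) (hint _ _)]
    _ = ellF k θ + 2 * ellK k := by rw [ellF_neg, ellK_eq_ellF hk]; ring

theorem ellF_add_int_mul_pi (hk : k ^ 2 < 1) (θ : ℝ) (m : ℤ) :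
    ellF k (θ + m * π) = ellF k θ + m * (2 * ellK k) := by
  let f : AddConstMap ℝ ℝ π (2 * ellK k) := ⟨ellF k, ellF_add_pi hk⟩
  have h := AddConstMapClass.map_add_zsmul f θ m
  rwa [zsmul_eq_mul, zsmul_eq_mul] at h

theorem ellF_jacobiAm (hk : k ^ 2 < 1) (y : ℝ) : ellF k (jacobiAm y k) = y :=
  Function.rightInverse_invFun (surjective_ellF hk) y

theorem jacobiAm_eq_iff (hk : k ^ 2 < 1) {y θ : ℝ} : jacobiAm y k = θ ↔ y = ellF k θ := by
  rw [← (strictMono_ellF hk).injective.eq_iff, ellF_jacobiAm hk]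

theorem jacobiAm_neg (hk : k ^ 2 < 1) (y : ℝ) : jacobiAm (-y) k = -jacobiAm y k := by
  rw [jacobiAm_eq_iff hk, ellF_neg, ellF_jacobiAm hk]

theorem jacobiAm_add_two_mul_ellK (hk : k ^ 2 < 1) (y : ℝ) :
    jacobiAm (y + 2 * ellK k) k = jacobiAm y k + π := by
  rw [jacobiAm_eq_iff hk, ellF_add_pi hk, ellF_jacobiAm hk]

theorem jacobiAm_eq_add_int_mul_two_pi_iff (hk : k ^ 2 < 1) {y z : ℝ} {m : ℤ} :
    jacobiAm z k = jacobiAm y k + m * (2 * π) ↔ z = y + m * (4 * ellK k) := by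
  have h := ellF_add_int_mul_pi hk (jacobiAm y k) (2 * m)
  push_cast at h
  rw [jacobiAm_eq_iff hk, show (m : ℝ) * (2 * π) = 2 * m * π by ring, h, ellF_jacobiAm hk,
    show 2 * (m : ℝ) * (2 * ellK k) = m * (4 * ellK k) by ring]

theorem continuous_jacobiAm (hk : k ^ 2 < 1) : Continuous fun y => jacobiAm y k := by
  let e := (strictMono_ellF hk).orderIsoOfSurjective _ (surjective_ellF hk)
  have he : (fun y => jacobiAm y k) = e.symm :=
    funext fun y => (jacobiAm_eq_iff hk).2 (e.apply_symm_apply y).symm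
  exact he ▸ e.symm.continuous

end Amplitude

/-! ### Elliptic functions -/

section Elliptic

variable {k : ℝ}

/-- The Jacobi elliptic sine `sn(y; k)`. -/
noncomputable def jacobiSn (y k : ℝ) : ℝ := sin (jacobiAm y k)

/-- The Jacobi delta amplitude `dn(y; k)`, which is the derivative of the amplitude. -/
noncomputable def jacobiDn (y k : ℝ) : ℝ := √(1 - k ^ 2 * jacobiSn y k ^ 2)

/-- The derivative `cn' = -sn dn` of the elliptic cosine. -/
noncomputable def jacobiCnDeriv (y k : ℝ) : ℝ := -(jacobiSn y k * jacobiDn y k)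

theorem jacobiSn_sq (y k : ℝ) : jacobiSn y k ^ 2 = 1 - jacobiCn y k ^ 2 := sin_sq _

theorem jacobiDn_pos (hk : k ^ 2 < 1) (y : ℝ) : 0 < jacobiDn y k :=
  sqrt_pos.2 (one_sub_sq_mul_sin_sq_pos hk _)

theorem jacobiDn_sq (hk : k ^ 2 < 1) (y : ℝ) :
    jacobiDn y k ^ 2 = 1 - k ^ 2 * (1 - jacobiCn y k ^ 2) := by
  rw [← jacobiSn_sq]
  exact sq_sqrt (one_sub_sq_mul_sin_sq_pos hk _).le

theorem jacobiCnDeriv_sq (hk : k ^ 2 < 1) (y : ℝ) :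
    jacobiCnDeriv y k ^ 2 = (1 - jacobiCn y k ^ 2) * (1 - k ^ 2 * (1 - jacobiCn y k ^ 2)) := by
  rw [jacobiCnDeriv, neg_sq, mul_pow, jacobiSn_sq, jacobiDn_sq hk]

theorem hasDerivAt_jacobiAm (hk : k ^ 2 < 1) (y : ℝ) :
    HasDerivAt (fun y => jacobiAm y k) (jacobiDn y k) y := by
  refine (HasDerivAt.of_local_left_inverse (continuous_jacobiAm hk).continuousAt
    (hasDerivAt_ellF hk (jacobiAm y k)) (one_div_ne_zero (jacobiDn_pos hk y).ne')
    (Eventually.of_forall fun y => ellF_jacobiAm hk y)).congr_deriv ?_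
  rw [one_div, inv_inv]
  rfl

theorem hasDerivAt_jacobiCn (hk : k ^ 2 < 1) (y : ℝ) :
    HasDerivAt (fun y => jacobiCn y k) (jacobiCnDeriv y k) y :=
  (hasDerivAt_jacobiAm hk y).cos.congr_deriv (neg_mul _ _)

theorem hasDerivAt_jacobiSn (hk : k ^ 2 < 1) (y : ℝ) :
    HasDerivAt (fun y => jacobiSn y k) (jacobiCn y k * jacobiDn y k) y :=
  (hasDerivAt_jacobiAm hk y).sin

theorem hasDerivAt_jacobiDn (hk : k ^ 2 < 1) (y : ℝ) :
    HasDerivAt (fun y => jacobiDn y k) (-(k ^ 2 * jacobiSn y k * jacobiCn y k)) y := by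
  have h := ((((hasDerivAt_jacobiSn hk y).pow 2).const_mul (k ^ 2)).const_sub 1).sqrt
    (one_sub_sq_mul_sin_sq_pos hk _).ne'
  refine h.congr_deriv ?_
  have hdn := (jacobiDn_pos hk y).ne'
  change -(k ^ 2 * (2 * jacobiSn y k ^ 1 * (jacobiCn y k * jacobiDn y k))) / (2 * jacobiDn y k) = _
  field_simp

theorem hasDerivAt_jacobiCnDeriv (hk : k ^ 2 < 1) (y : ℝ) :
    HasDerivAt (fun y => jacobiCnDeriv y k)
      ((2 * k ^ 2 - 1) * jacobiCn y k - 2 * k ^ 2 * jacobiCn y k ^ 3) y := by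
  refine ((hasDerivAt_jacobiSn hk y).mul (hasDerivAt_jacobiDn hk y)).neg.congr_deriv ?_
  linear_combination
    -jacobiCn y k * jacobiDn_sq hk y + k ^ 2 * jacobiCn y k * jacobiSn_sq y k

theorem jacobiCn_neg (hk : k ^ 2 < 1) (y : ℝ) : jacobiCn (-y) k = jacobiCn y k := by
  simp [jacobiCn, jacobiAm_neg hk]

theorem jacobiCnDeriv_neg (hk : k ^ 2 < 1) (y : ℝ) :
    jacobiCnDeriv (-y) k = -jacobiCnDeriv y k := by
  simp [jacobiCnDeriv, jacobiDn, jacobiSn, jacobiAm_neg hk]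

theorem jacobiCn_antiperiodic (hk : k ^ 2 < 1) :
    Function.Antiperiodic (fun y => jacobiCn y k) (2 * ellK k) := fun y => by
  simp [jacobiCn, jacobiAm_add_two_mul_ellK hk]

theorem jacobiCnDeriv_antiperiodic (hk : k ^ 2 < 1) :
    Function.Antiperiodic (fun y => jacobiCnDeriv y k) (2 * ellK k) := fun y => by
  simp [jacobiCnDeriv, jacobiDn, jacobiSn, jacobiAm_add_two_mul_ellK hk, sin_add_pi]

theorem jacobiCn_eq_iff (hk : k ^ 2 < 1) {y z : ℝ} :
    jacobiCn y k = jacobiCn z k ↔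
      ∃ m : ℤ, z = y + m * (4 * ellK k) ∨ z = -y + m * (4 * ellK k) := by
  rw [jacobiCn, jacobiCn, cos_eq_cos_iff]
  refine exists_congr fun m => or_congr ?_ ?_
  · rw [← jacobiAm_eq_add_int_mul_two_pi_iff hk]
    ring_nf
  · rw [← jacobiAm_eq_add_int_mul_two_pi_iff hk, jacobiAm_neg hk]
    ring_nf

theorem eq_add_period_of_jacobiCn_eq (hk : k ^ 2 < 1) {y z : ℝ}
    (h : jacobiCn y k = jacobiCn z k) (h' : jacobiCnDeriv y k = jacobiCnDeriv z k) :
    ∃ m : ℤ, z = y + m * (4 * ellK k) := by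
  have hdn : jacobiDn y k = jacobiDn z k := by simp only [jacobiDn, jacobiSn_sq, h]
  have hsn : jacobiSn y k = jacobiSn z k := by
    simp only [jacobiCnDeriv, hdn, neg_inj] at h'
    exact mul_right_cancel₀ (jacobiDn_pos hk z).ne' h'
  have hangle : (jacobiAm z k : Real.Angle) = jacobiAm y k := Angle.cos_sin_inj h.symm hsn.symm
  obtain ⟨m, hm⟩ := Angle.angle_eq_iff_two_pi_dvd_sub.1 hangle
  exact ⟨m, (jacobiAm_eq_add_int_mul_two_pi_iff hk).1 (by linarith)⟩

end Elliptic

/-! ### The functions `S` and `φ` of the modulus -/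

section Modulus

variable {k : ℝ}

theorem one_div_sqrt_two_sq : (1 / √2 : ℝ) ^ 2 = 1 / 2 := by
  rw [div_pow, sq_sqrt zero_le_two, one_pow]

theorem mem_Ico_one_div_sqrt_two_iff :
    k ∈ Ico (1 / √2) 1 ↔ 0 < k ∧ 1 / 2 ≤ k ^ 2 ∧ k ^ 2 < 1 := by
  have h2 : (0 : ℝ) < 1 / √2 := by positivity
  constructor
  · rintro ⟨h, h1⟩
    have h0 : 0 < k := h2.trans_le h
    exact ⟨h0, one_div_sqrt_two_sq ▸ pow_le_pow_left₀ h2.le h 2, by nlinarith⟩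
  · rintro ⟨h0, h, h1⟩
    exact ⟨le_of_sq_le_sq (by rwa [one_div_sqrt_two_sq]) h0.le, by nlinarith⟩

theorem mem_modulusRange_iff : k ∈ modulusRange ↔ 0 < k ∧ 1 / 2 < k ^ 2 ∧ k ^ 2 < 1 := by
  have h2 : (0 : ℝ) < 1 / √2 := by positivity
  constructor
  · rintro ⟨h, h1⟩
    have h0 : 0 < k := h2.trans h
    exact ⟨h0, one_div_sqrt_two_sq ▸ pow_lt_pow_left₀ h h2.le two_ne_zero, by nlinarith⟩
  · rintro ⟨h0, h, h1⟩
    exact ⟨lt_of_pow_lt_pow_left₀ 2 h0.le (by rwa [one_div_sqrt_two_sq]), by nlinarith⟩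

theorem pos_of_mem_modulusRange (hk : k ∈ modulusRange) : 0 < k := (mem_modulusRange_iff.1 hk).1

theorem half_lt_sq_of_mem_modulusRange (hk : k ∈ modulusRange) : 1 / 2 < k ^ 2 :=
  (mem_modulusRange_iff.1 hk).2.1

theorem sq_lt_one_of_mem_modulusRange (hk : k ∈ modulusRange) : k ^ 2 < 1 :=
  (mem_modulusRange_iff.1 hk).2.2

theorem sq_lt_one_of_mem_Ico (hk : k ∈ Ico (1 / √2) 1) : k ^ 2 < 1 :=
  (mem_Ico_one_div_sqrt_two_iff.1 hk).2.2

theorem modulusRange_subset_Ico : modulusRange ⊆ Ico (1 / √2) 1 := Ioo_subset_Ico_self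

theorem one_div_sqrt_two_mem_Ico : (1 / √2 : ℝ) ∈ Ico (1 / √2) 1 :=
  mem_Ico_one_div_sqrt_two_iff.2
    ⟨by positivity, one_div_sqrt_two_sq.ge, one_div_sqrt_two_sq.trans_lt one_half_lt_one⟩

theorem eventually_mem_modulusRange : ∀ᶠ k in 𝓝[<] 1, k ∈ modulusRange :=
  Ioo_mem_nhdsLT one_div_sqrt_two_mem_Ico.2

theorem ellF_le_ellF_of_modulus_le {a b θ : ℝ} (ha : 0 ≤ a) (hab : a ≤ b) (hb : b ^ 2 < 1)
    (hθ : 0 ≤ θ) : ellF a θ ≤ ellF b θ := by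
  have hsq : a ^ 2 ≤ b ^ 2 := pow_le_pow_left₀ ha hab 2
  refine intervalIntegral.integral_mono_on hθ
    ((continuous_ellF_integrand (hsq.trans_lt hb)).intervalIntegrable _ _)
    ((continuous_ellF_integrand hb).intervalIntegrable _ _) fun x _ => ?_
  refine one_div_le_one_div_of_le (sqrt_pos.2 (one_sub_sq_mul_sin_sq_pos hb x)) (sqrt_le_sqrt ?_)
  gcongr

theorem continuousOn_ellF_modulus {A : Set ℝ} (hA : ∀ k ∈ A, k ^ 2 < 1) {s : ℝ → ℝ}
    (hs : ContinuousOn s A) : ContinuousOn (fun k => ellF k (s k)) A := by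
  rw [continuousOn_iff_continuous_domRestrict] at hs ⊢
  refine intervalIntegral.continuous_parametric_intervalIntegral_of_continuous
    (f := fun (k : A) θ => 1 / √(1 - (k : ℝ) ^ 2 * sin θ ^ 2)) ?_ hs
  exact Continuous.div (by fun_prop) (by fun_prop)
    fun p => (sqrt_pos.2 (one_sub_sq_mul_sin_sq_pos (hA p.1 p.1.2) p.2)).ne'

theorem ellK_le_ellK {a b : ℝ} (ha : 0 ≤ a) (hab : a ≤ b) (hb : b ^ 2 < 1) :
    ellK a ≤ ellK b := by
  rw [ellK_eq_ellF ((pow_le_pow_left₀ ha hab 2).trans_lt hb), ellK_eq_ellF hb]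
  exact ellF_le_ellF_of_modulus_le ha hab hb (by positivity)

theorem one_le_ellK (hk : k ^ 2 < 1) : 1 ≤ ellK k := by
  rw [ellK_eq_ellF hk]
  exact one_le_pi_div_two.trans (le_ellF hk (by positivity))

theorem ellK_pos (hk : k ^ 2 < 1) : 0 < ellK k := one_pos.trans_le (one_le_ellK hk)

theorem continuousOn_ellK : ContinuousOn ellK (Ico (1 / √2) 1) :=
  (continuousOn_ellF_modulus (s := fun _ => π / 2) (fun _ => sq_lt_one_of_mem_Ico)
    continuousOn_const).congr fun _ hk => ellK_eq_ellF (sq_lt_one_of_mem_Ico hk)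

theorem sqrt_one_sub_sq_mul_sin_sq_le {c x : ℝ} (hc : 0 ≤ c) (h : k ^ 2 + c ^ 2 = 1)
    (hx : x ∈ Icc 0 (π / 2)) : √(1 - k ^ 2 * sin x ^ 2) ≤ π / 2 + c - x := by
  have hcos0 : 0 ≤ cos x := cos_nonneg_of_mem_Icc ⟨by linarith [hx.1, pi_pos], hx.2⟩
  have hcos : cos x ≤ π / 2 - x := by
    rw [← sin_pi_div_two_sub]
    exact sin_le (by linarith [hx.2])
  have hle : √(1 - k ^ 2 * sin x ^ 2) ≤ cos x + c := by
    refine sqrt_le_iff.2 ⟨by linarith, ?_⟩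
    nlinarith [sin_sq_add_cos_sq x, mul_nonneg hcos0 hc,
      mul_nonneg (sq_nonneg c) (sq_nonneg (cos x))]
  linarith

theorem neg_log_le_ellK {c : ℝ} (hc : 0 < c) (h : k ^ 2 + c ^ 2 = 1) : -log c ≤ ellK k := by
  have hk : k ^ 2 < 1 := by nlinarith
  have hpos : ∀ x ∈ Icc 0 (π / 2), 0 < π / 2 + c - x := fun x hx => by linarith [hx.2]
  have hint : IntervalIntegrable (fun x => 1 / (π / 2 + c - x)) volume 0 (π / 2) := by
    refine ContinuousOn.intervalIntegrable (ContinuousOn.div (by fun_prop) (by fun_prop) ?_)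
    rw [uIcc_of_le (by positivity)]
    exact fun x hx => (hpos x hx).ne'
  calc -log c ≤ log (π / 2 + c) - log c := by
        linarith [log_nonneg (by linarith [one_le_pi_div_two] : 1 ≤ π / 2 + c)]
    _ = ∫ x in (0 : ℝ)..π / 2, 1 / (π / 2 + c - x) := by
        rw [intervalIntegral.integral_comp_sub_left (fun x => 1 / x), add_sub_cancel_left,
          sub_zero, integral_one_div_of_pos hc (by positivity), log_div (by positivity) hc.ne']
    _ ≤ ∫ x in (0 : ℝ)..π / 2, 1 / √(1 - k ^ 2 * sin x ^ 2) :=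
        intervalIntegral.integral_mono_on (by positivity) hint
          ((continuous_ellF_integrand hk).intervalIntegrable _ _) fun x hx =>
          one_div_le_one_div_of_le (sqrt_pos.2 (one_sub_sq_mul_sin_sq_pos hk x))
            (sqrt_one_sub_sq_mul_sin_sq_le hc.le h hx)
    _ = ellK k := (ellK_eq_ellF hk).symm

theorem tendsto_ellK_atTop : Tendsto ellK (𝓝[<] 1) atTop := by
  have hroot : Tendsto (fun k : ℝ => √(1 - k ^ 2)) (𝓝[<] 1) (𝓝[>] 0) := by
    refine tendsto_nhdsWithin_iff.2 ⟨?_, eventually_mem_modulusRange.mono fun k hk =>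
      sqrt_pos.2 (sub_pos.2 (sq_lt_one_of_mem_modulusRange hk))⟩
    have hcont : Continuous fun k : ℝ => √(1 - k ^ 2) := by fun_prop
    simpa using (hcont.tendsto 1).mono_left nhdsWithin_le_nhds
  refine tendsto_atTop_mono' _ (eventually_mem_modulusRange.mono fun k hk => ?_)
    (tendsto_neg_atBot_atTop.comp (tendsto_log_nhdsGT_zero.comp hroot))
  have hlt : 0 < 1 - k ^ 2 := sub_pos.2 (sq_lt_one_of_mem_modulusRange hk)
  exact neg_log_le_ellK (sqrt_pos.2 hlt) (by rw [sq_sqrt hlt.le]; ring)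

theorem S_pos (hk : k ∈ modulusRange) : 0 < S k := by
  have hK := ellK_pos (sq_lt_one_of_mem_modulusRange hk)
  have hroot : 0 < √(2 * k ^ 2 - 1) :=
    sqrt_pos.2 (by linarith [half_lt_sq_of_mem_modulusRange hk])
  unfold S
  positivity

theorem strictMonoOn_S : StrictMonoOn S modulusRange := by
  intro a ha b hb hab
  have ha0 := pos_of_mem_modulusRange ha
  have hsq : a ^ 2 < b ^ 2 := pow_lt_pow_left₀ hab ha0.le two_ne_zero
  have hroot : √(2 * a ^ 2 - 1) < √(2 * b ^ 2 - 1) :=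
    sqrt_lt_sqrt (by linarith [half_lt_sq_of_mem_modulusRange ha]) (by linarith)
  exact mul_lt_mul (by linarith)
    (ellK_le_ellK ha0.le hab.le (sq_lt_one_of_mem_modulusRange hb))
    (ellK_pos (sq_lt_one_of_mem_modulusRange ha)) (by positivity)

theorem tendsto_S_atTop : Tendsto S (𝓝[<] 1) atTop := by
  have hcont : Continuous fun k : ℝ => 4 * √(2 * k ^ 2 - 1) := by fun_prop
  refine Tendsto.pos_mul_atTop (C := 4 * √(2 * 1 ^ 2 - 1)) ?_
    ((hcont.tendsto 1).mono_left nhdsWithin_le_nhds) tendsto_ellK_atTop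
  norm_num

theorem bijOn_S : BijOn S modulusRange (Ioi 0) := by
  refine ⟨fun k hk => S_pos hk, strictMonoOn_S.injOn, fun y hy => ?_⟩
  have hzero : S (1 / √2) = 0 := by rw [S, one_div_sqrt_two_sq]; norm_num
  have hcont : ContinuousOn S (Ico (1 / √2) 1) :=
    ContinuousOn.mul (by fun_prop) continuousOn_ellK
  obtain ⟨k, hk, rfl⟩ := isPreconnected_Ico.intermediate_value_Ici one_div_sqrt_two_mem_Ico
    (le_principal_iff.2 (Ico_mem_nhdsLT one_div_sqrt_two_mem_Ico.2)) hcont tendsto_S_atTop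
    (hzero.trans_le (mem_Ioi.1 hy).le)
  refine ⟨k, ⟨lt_of_le_of_ne hk.1 ?_, hk.2⟩, rfl⟩
  rintro rfl
  exact (mem_Ioi.1 hy).ne' hzero

theorem SInv_mem {y : ℝ} (hy : 0 < y) : SInv y ∈ modulusRange :=
  Function.invFunOn_mem (bijOn_S.surjOn hy)

theorem S_SInv {y : ℝ} (hy : 0 < y) : S (SInv y) = y :=
  Function.invFunOn_eq (bijOn_S.surjOn hy)

theorem SInv_S (hk : k ∈ modulusRange) : SInv (S k) = k :=
  bijOn_S.injOn.leftInvOn_invFunOn hk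

theorem shiftIntegral_eq_ellF (hk : k ∈ Ico (1 / √2) 1) :
    shiftIntegral k = ellF k (arcsin √((1 - k ^ 2) / k ^ 2)) := by
  obtain ⟨h0, h1, h2⟩ := mem_Ico_one_div_sqrt_two_iff.1 hk
  rw [shiftIntegral, integral_eq_ellF_arccos h2 (sqrt_nonneg _)
    (sqrt_le_one.2 (by rw [div_le_one (by positivity)]; linarith)),
    arccos_eq_arcsin (sqrt_nonneg _), sq_sqrt (div_nonneg (by linarith) (by positivity))]
  congr 3
  field_simp
  ring

/-- The integrand of `shiftIntegral k` after the substitution that moves the range of integration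
to `(0, 1)`, without the constant factor `√((1 - k²) / k²)`. In this form the dependence on `k` is
monotone. -/
noncomputable def shiftDensity (k t : ℝ) : ℝ :=
  1 / (√(1 - (1 - k ^ 2) / k ^ 2 * t ^ 2) * √(1 - (1 - k ^ 2) * t ^ 2))

theorem shiftDensity_radicands_pos (hk : k ∈ modulusRange) {t : ℝ} (ht : t ∈ Icc (0 : ℝ) 1) :
    0 < 1 - (1 - k ^ 2) / k ^ 2 * t ^ 2 ∧ 0 < 1 - (1 - k ^ 2) * t ^ 2 := by
  obtain ⟨-, h1, h2⟩ := mem_modulusRange_iff.1 hk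
  have hlt : (1 - k ^ 2) / k ^ 2 < 1 := by rw [div_lt_one (by linarith)]; linarith
  have hnonneg : 0 ≤ (1 - k ^ 2) / k ^ 2 := div_nonneg (by linarith) (by linarith)
  have ht2 : t ^ 2 ≤ 1 := by nlinarith [ht.1, ht.2]
  constructor <;> nlinarith [sq_nonneg t]

theorem shiftDensity_denom_pos (hk : k ∈ modulusRange) {t : ℝ} (ht : t ∈ Icc (0 : ℝ) 1) :
    0 < √(1 - (1 - k ^ 2) / k ^ 2 * t ^ 2) * √(1 - (1 - k ^ 2) * t ^ 2) :=
  mul_pos (sqrt_pos.2 (shiftDensity_radicands_pos hk ht).1)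
    (sqrt_pos.2 (shiftDensity_radicands_pos hk ht).2)

theorem intervalIntegrable_shiftDensity (hk : k ∈ modulusRange) :
    IntervalIntegrable (shiftDensity k) volume 0 1 := by
  refine ContinuousOn.intervalIntegrable (ContinuousOn.div (by fun_prop) (by fun_prop) ?_)
  rw [uIcc_of_le zero_le_one]
  exact fun t ht => (shiftDensity_denom_pos hk ht).ne'

theorem integral_shiftDensity_pos (hk : k ∈ modulusRange) :
    0 < ∫ t in (0 : ℝ)..1, shiftDensity k t :=
  intervalIntegral.intervalIntegral_pos_of_pos_on (intervalIntegrable_shiftDensity hk)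
    (fun _ ht => one_div_pos.2 (shiftDensity_denom_pos hk (Ioo_subset_Icc_self ht))) zero_lt_one

theorem integral_shiftDensity_anti {a b : ℝ} (ha : a ∈ modulusRange) (hb : b ∈ modulusRange)
    (hab : a ≤ b) :
    ∫ t in (0 : ℝ)..1, shiftDensity b t ≤ ∫ t in (0 : ℝ)..1, shiftDensity a t := by
  have ha0 := pos_of_mem_modulusRange ha
  have ha1 : 0 ≤ 1 - a ^ 2 := by linarith [sq_lt_one_of_mem_modulusRange ha]
  refine intervalIntegral.integral_mono_on zero_le_one (intervalIntegrable_shiftDensity hb)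
    (intervalIntegrable_shiftDensity ha) fun t ht =>
    one_div_le_one_div_of_le (shiftDensity_denom_pos ha ht) ?_
  gcongr

theorem shiftIntegral_eq_mul_integral (hk : k ∈ modulusRange) :
    shiftIntegral k = √((1 - k ^ 2) / k ^ 2) * ∫ t in (0 : ℝ)..1, shiftDensity k t := by
  obtain ⟨h0, h1, h2⟩ := mem_modulusRange_iff.1 hk
  have hle : √((1 - k ^ 2) / k ^ 2) ≤ 1 :=
    sqrt_le_one.2 (by rw [div_le_one (by positivity)]; linarith)
  have hsq : √((1 - k ^ 2) / k ^ 2) ^ 2 = (1 - k ^ 2) / k ^ 2 :=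
    sq_sqrt (div_nonneg (by linarith) (by positivity))
  have hmul : k ^ 2 * ((1 - k ^ 2) / k ^ 2) = 1 - k ^ 2 := by field_simp
  rw [shiftIntegral_eq_ellF (modulusRange_subset_Ico hk),
    ← integral_eq_ellF_arcsin h2 (sqrt_nonneg _) hle]
  have hsubst := intervalIntegral.mul_integral_comp_mul_left (a := 0) (b := 1)
    (f := fun t => 1 / √((1 - t ^ 2) * (1 - k ^ 2 * t ^ 2))) (c := √((1 - k ^ 2) / k ^ 2))
  rw [mul_zero, mul_one] at hsubst
  rw [← hsubst]
  congr 1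
  refine intervalIntegral.integral_congr fun t ht => ?_
  rw [uIcc_of_le zero_le_one] at ht
  simp only [shiftDensity, mul_pow, hsq, ← mul_assoc, hmul]
  rw [sqrt_mul (shiftDensity_radicands_pos hk ht).1.le]

theorem shiftIntegral_pos (hk : k ∈ modulusRange) : 0 < shiftIntegral k := by
  have h0 := pos_of_mem_modulusRange hk
  have h1 : 0 < 1 - k ^ 2 := by linarith [sq_lt_one_of_mem_modulusRange hk]
  rw [shiftIntegral_eq_mul_integral hk]
  exact mul_pos (sqrt_pos.2 (by positivity)) (integral_shiftDensity_pos hk)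

theorem shiftIntegral_lt_ellK (hk : k ∈ modulusRange) : shiftIntegral k < ellK k := by
  obtain ⟨h0, h1, h2⟩ := mem_modulusRange_iff.1 hk
  rw [shiftIntegral_eq_ellF (modulusRange_subset_Ico hk), ellK_eq_ellF h2]
  refine strictMono_ellF h2 (arcsin_lt_pi_div_two.2 ((sqrt_lt' one_pos).2 ?_))
  rw [div_lt_iff₀ (by positivity)]
  linarith

theorem strictAntiOn_shiftIntegral : StrictAntiOn shiftIntegral modulusRange := by
  intro a ha b hb hab
  have ha0 := pos_of_mem_modulusRange ha
  have ha1 : 0 < 1 - a ^ 2 := by linarith [sq_lt_one_of_mem_modulusRange ha]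
  have hb1 : 0 < 1 - b ^ 2 := by linarith [sq_lt_one_of_mem_modulusRange hb]
  have hb0 := pos_of_mem_modulusRange hb
  rw [shiftIntegral_eq_mul_integral ha, shiftIntegral_eq_mul_integral hb]
  refine mul_lt_mul (sqrt_lt_sqrt (by positivity) ?_) (integral_shiftDensity_anti ha hb hab.le)
    (integral_shiftDensity_pos hb) (sqrt_nonneg _)
  gcongr

theorem strictAntiOn_phi : StrictAntiOn phi modulusRange := fun _ ha _ hb hab =>
  div_lt_div₀ (strictAntiOn_shiftIntegral ha hb hab)
    (ellK_le_ellK (pos_of_mem_modulusRange ha).le hab.le (sq_lt_one_of_mem_modulusRange hb))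
    (shiftIntegral_pos ha).le (ellK_pos (sq_lt_one_of_mem_modulusRange ha))

theorem phi_mem_Ioo (hk : k ∈ modulusRange) : phi k ∈ Ioo 0 1 :=
  have hK := ellK_pos (sq_lt_one_of_mem_modulusRange hk)
  ⟨div_pos (shiftIntegral_pos hk) hK, (div_lt_one hK).2 (shiftIntegral_lt_ellK hk)⟩

theorem phi_one_div_sqrt_two : phi (1 / √2) = 1 := by
  have hmem := one_div_sqrt_two_mem_Ico
  have hK := ellK_pos (sq_lt_one_of_mem_Ico hmem)
  rw [phi, div_eq_one_iff_eq hK.ne', shiftIntegral_eq_ellF hmem,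
    ellK_eq_ellF (sq_lt_one_of_mem_Ico hmem), one_div_sqrt_two_sq]
  norm_num

theorem continuousOn_phi : ContinuousOn phi (Ico (1 / √2) 1) := by
  have harcsin : ContinuousOn (fun k : ℝ => arcsin √((1 - k ^ 2) / k ^ 2)) (Ico (1 / √2) 1) :=
    continuous_arcsin.comp_continuousOn (ContinuousOn.sqrt (ContinuousOn.div (by fun_prop)
      (by fun_prop) fun k hk => (pow_pos (mem_Ico_one_div_sqrt_two_iff.1 hk).1 2).ne'))
  have hshift : ContinuousOn shiftIntegral (Ico (1 / √2) 1) :=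
    (continuousOn_ellF_modulus (fun _ => sq_lt_one_of_mem_Ico) harcsin).congr
      fun _ => shiftIntegral_eq_ellF
  exact hshift.div continuousOn_ellK fun k hk => (ellK_pos (sq_lt_one_of_mem_Ico hk)).ne'

theorem tendsto_phi_zero : Tendsto phi (𝓝[<] 1) (𝓝 0) := by
  obtain ⟨a, ha⟩ : modulusRange.Nonempty := nonempty_Ioo.2 one_div_sqrt_two_mem_Ico.2
  have hroot : Tendsto (fun k : ℝ => √((1 - k ^ 2) / k ^ 2)) (𝓝[<] 1) (𝓝 0) := by
    have hcont : ContinuousAt (fun k : ℝ => √((1 - k ^ 2) / k ^ 2)) 1 :=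
      ContinuousAt.sqrt (ContinuousAt.div (by fun_prop) (by fun_prop) (by norm_num))
    simpa [ContinuousAt] using hcont.tendsto.mono_left nhdsWithin_le_nhds
  refine squeeze_zero' (eventually_mem_modulusRange.mono fun k hk => (phi_mem_Ioo hk).1.le) ?_
    (by simpa using hroot.mul_const (∫ t in (0 : ℝ)..1, shiftDensity a t))
  filter_upwards [eventually_mem_modulusRange, Ioo_mem_nhdsLT ha.2] with k hk hak
  calc phi k ≤ shiftIntegral k :=
        div_le_self (shiftIntegral_pos hk).le (one_le_ellK (sq_lt_one_of_mem_modulusRange hk))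
    _ = √((1 - k ^ 2) / k ^ 2) * ∫ t in (0 : ℝ)..1, shiftDensity k t :=
        shiftIntegral_eq_mul_integral hk
    _ ≤ √((1 - k ^ 2) / k ^ 2) * ∫ t in (0 : ℝ)..1, shiftDensity a t := by
        gcongr
        exact integral_shiftDensity_anti ha hk hak.1.le

theorem bijOn_phi : BijOn phi modulusRange (Ioo 0 1) := by
  refine ⟨fun k hk => phi_mem_Ioo hk, strictAntiOn_phi.injOn, fun y hy => ?_⟩
  obtain ⟨k, hk, rfl⟩ := isPreconnected_Ico.intermediate_value_Ioc one_div_sqrt_two_mem_Ico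
    (le_principal_iff.2 (Ico_mem_nhdsLT one_div_sqrt_two_mem_Ico.2)) continuousOn_phi
    tendsto_phi_zero ⟨hy.1, hy.2.le.trans phi_one_div_sqrt_two.ge⟩
  refine ⟨k, ⟨lt_of_le_of_ne hk.1 ?_, hk.2⟩, rfl⟩
  rintro rfl
  exact hy.2.ne phi_one_div_sqrt_two

theorem phiInv_mem {y : ℝ} (hy : y ∈ Ioo 0 1) : phiInv y ∈ modulusRange :=
  Function.invFunOn_mem (bijOn_phi.surjOn hy)

theorem phi_phiInv {y : ℝ} (hy : y ∈ Ioo 0 1) : phi (phiInv y) = y :=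
  Function.invFunOn_eq (bijOn_phi.surjOn hy)

theorem phiInv_phi (hk : k ∈ modulusRange) : phiInv (phi k) = k :=
  bijOn_phi.injOn.leftInvOn_invFunOn hk

end Modulus

/-! ### Cnoidal profiles -/

noncomputable section Profile

/-- The amplitude of the cnoidal wave of modulus `k` and frequency parameter `ω`. -/
def profileAmp (k ω : ℝ) : ℝ := √(2 * |ω| * k ^ 2 / (2 * k ^ 2 - 1))

/-- The factor by which the cnoidal wave of modulus `k` and frequency parameter `ω` rescales the
argument of the elliptic cosine. -/
def profileFreq (k ω : ℝ) : ℝ := √(|ω| / (2 * k ^ 2 - 1))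

/-- The cnoidal wave of modulus `k` and frequency parameter `ω`; unlike `cnoidal`, it treats the
modulus as a free parameter. -/
def profile (k ω x : ℝ) : ℝ := profileAmp k ω * jacobiCn (profileFreq k ω * x) k

/-- The derivative of `profile k ω`. -/
def profileDeriv (k ω x : ℝ) : ℝ :=
  profileAmp k ω * (profileFreq k ω * jacobiCnDeriv (profileFreq k ω * x) k)

/-- The period of `profile k ω`. -/
def profilePeriod (k ω : ℝ) : ℝ := 4 * ellK k / profileFreq k ω

/-- The first positive point at which `profile k ω` takes the value `√(2|ω|)`; for the modulus
`k_{n,ω}` it is the shift `γ_{n,ω}`. -/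
def profileShift (k ω : ℝ) : ℝ := shiftIntegral k / profileFreq k ω

variable {k ω : ℝ}

theorem two_mul_sq_sub_one_pos (hk : k ∈ modulusRange) : 0 < 2 * k ^ 2 - 1 := by
  linarith [half_lt_sq_of_mem_modulusRange hk]

theorem profileFreq_pos (hk : k ∈ modulusRange) (hω : ω < 0) : 0 < profileFreq k ω :=
  sqrt_pos.2 (div_pos (abs_pos.2 hω.ne) (two_mul_sq_sub_one_pos hk))

theorem profileAmp_pos (hk : k ∈ modulusRange) (hω : ω < 0) : 0 < profileAmp k ω := by
  have h0 := pos_of_mem_modulusRange hk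
  have hω' := abs_pos.2 hω.ne
  exact sqrt_pos.2 (div_pos (by positivity) (two_mul_sq_sub_one_pos hk))

theorem profileFreq_sq (hk : k ∈ modulusRange) :
    profileFreq k ω ^ 2 = |ω| / (2 * k ^ 2 - 1) :=
  sq_sqrt (div_nonneg (abs_nonneg _) (two_mul_sq_sub_one_pos hk).le)

theorem profileAmp_sq (hk : k ∈ modulusRange) :
    profileAmp k ω ^ 2 = 2 * k ^ 2 * profileFreq k ω ^ 2 := by
  have h := two_mul_sq_sub_one_pos hk
  rw [profileFreq_sq hk, profileAmp, sq_sqrt (by positivity)]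
  ring

theorem profileFreq_mul_profilePeriod (hk : k ∈ modulusRange) (hω : ω < 0) :
    profileFreq k ω * profilePeriod k ω = 4 * ellK k :=
  mul_div_cancel₀ _ (profileFreq_pos hk hω).ne'

theorem profileFreq_mul_profileShift (hk : k ∈ modulusRange) (hω : ω < 0) :
    profileFreq k ω * profileShift k ω = shiftIntegral k :=
  mul_div_cancel₀ _ (profileFreq_pos hk hω).ne'

theorem profilePeriod_pos (hk : k ∈ modulusRange) (hω : ω < 0) : 0 < profilePeriod k ω :=
  div_pos (mul_pos four_pos (ellK_pos (sq_lt_one_of_mem_modulusRange hk))) (profileFreq_pos hk hω)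

theorem profilePeriod_eq (k ω : ℝ) : profilePeriod k ω = S k / √|ω| := by
  rw [profilePeriod, profileFreq, sqrt_div (abs_nonneg _), S]
  ring_nf
  rw [inv_inv]
  ring

theorem profileShift_eq (hk : k ∈ modulusRange) :
    profileShift k ω = phi k * profilePeriod k ω / 4 := by
  have hK := (ellK_pos (sq_lt_one_of_mem_modulusRange hk)).ne'
  rw [profileShift, profilePeriod, phi]
  field_simp

theorem hasDerivAt_profile (hk : k ∈ modulusRange) (x : ℝ) :
    HasDerivAt (profile k ω) (profileDeriv k ω x) x := by
  have h := ((hasDerivAt_jacobiCn (sq_lt_one_of_mem_modulusRange hk) (profileFreq k ω * x)).comp x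
    ((hasDerivAt_id x).const_mul _)).const_mul (profileAmp k ω)
  exact h.congr_deriv (by rw [profileDeriv]; ring)

theorem hasDerivAt_profileDeriv (hk : k ∈ modulusRange) (hω : ω < 0) (x : ℝ) :
    HasDerivAt (profileDeriv k ω) (-(ω * profile k ω x) - profile k ω x ^ 3) x := by
  have h := (((hasDerivAt_jacobiCnDeriv (sq_lt_one_of_mem_modulusRange hk)
    (profileFreq k ω * x)).comp x ((hasDerivAt_id x).const_mul _)).const_mul
      (profileFreq k ω)).const_mul (profileAmp k ω)
  refine h.congr_deriv ?_
  have hfreq : (2 * k ^ 2 - 1) * profileFreq k ω ^ 2 = -ω := by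
    rw [profileFreq_sq hk, mul_div_cancel₀ _ (two_mul_sq_sub_one_pos hk).ne', abs_of_neg hω]
  rw [profile]
  linear_combination
    profileAmp k ω * jacobiCn (profileFreq k ω * x) k * hfreq +
      profileAmp k ω * jacobiCn (profileFreq k ω * x) k ^ 3 * profileAmp_sq (ω := ω) hk

theorem profile_neg (hk : k ∈ modulusRange) (x : ℝ) : profile k ω (-x) = profile k ω x := by
  simp only [profile, mul_neg, jacobiCn_neg (sq_lt_one_of_mem_modulusRange hk)]

theorem profileDeriv_neg (hk : k ∈ modulusRange) (x : ℝ) :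
    profileDeriv k ω (-x) = -profileDeriv k ω x := by
  simp only [profileDeriv, mul_neg, jacobiCnDeriv_neg (sq_lt_one_of_mem_modulusRange hk)]

theorem profileFreq_mul_add_half_period (hk : k ∈ modulusRange) (hω : ω < 0) (x : ℝ) :
    profileFreq k ω * (x + profilePeriod k ω / 2) = profileFreq k ω * x + 2 * ellK k := by
  linear_combination (1 / 2) * profileFreq_mul_profilePeriod hk hω

theorem profile_antiperiodic (hk : k ∈ modulusRange) (hω : ω < 0) :
    Function.Antiperiodic (profile k ω) (profilePeriod k ω / 2) := fun x => by
  have h := jacobiCn_antiperiodic (sq_lt_one_of_mem_modulusRange hk) (profileFreq k ω * x)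
  dsimp only at h
  rw [profile, profileFreq_mul_add_half_period hk hω, h, profile, mul_neg]

theorem profileDeriv_antiperiodic (hk : k ∈ modulusRange) (hω : ω < 0) :
    Function.Antiperiodic (profileDeriv k ω) (profilePeriod k ω / 2) := fun x => by
  have h := jacobiCnDeriv_antiperiodic (sq_lt_one_of_mem_modulusRange hk) (profileFreq k ω * x)
  dsimp only at h
  rw [profileDeriv, profileFreq_mul_add_half_period hk hω, h, profileDeriv, mul_neg, mul_neg]

theorem profile_eq_iff (hk : k ∈ modulusRange) (hω : ω < 0) {y z : ℝ} :
    profile k ω y = profile k ω z ↔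
      ∃ m : ℤ, z = y + m * profilePeriod k ω ∨ z = -y + m * profilePeriod k ω := by
  have hfreq := (profileFreq_pos hk hω).ne'
  rw [profile, profile, mul_right_inj' (profileAmp_pos hk hω).ne',
    jacobiCn_eq_iff (sq_lt_one_of_mem_modulusRange hk), ← profileFreq_mul_profilePeriod hk hω]
  refine exists_congr fun m => or_congr ?_ ?_
  all_goals
    rw [← mul_right_inj' hfreq (b := z)]
    ring_nf

theorem eq_add_period_of_profile_eq (hk : k ∈ modulusRange) (hω : ω < 0) {y z : ℝ}
    (h : profile k ω y = profile k ω z) (h' : profileDeriv k ω y = profileDeriv k ω z) :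
    ∃ m : ℤ, z = y + m * profilePeriod k ω := by
  have hfreq := (profileFreq_pos hk hω).ne'
  have hamp := (profileAmp_pos hk hω).ne'
  obtain ⟨m, hm⟩ := eq_add_period_of_jacobiCn_eq (sq_lt_one_of_mem_modulusRange hk)
    (mul_left_cancel₀ hamp h) (mul_left_cancel₀ hfreq (mul_left_cancel₀ hamp h'))
  refine ⟨m, mul_left_cancel₀ hfreq ?_⟩
  rw [hm, ← profileFreq_mul_profilePeriod hk hω]
  ring

theorem jacobiCn_shiftIntegral (hk : k ∈ modulusRange) :
    jacobiCn (shiftIntegral k) k = √((2 * k ^ 2 - 1) / k ^ 2) := by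
  obtain ⟨h0, -, h2⟩ := mem_modulusRange_iff.1 hk
  rw [jacobiCn, (jacobiAm_eq_iff h2).2 (shiftIntegral_eq_ellF (modulusRange_subset_Ico hk)),
    cos_arcsin, sq_sqrt (div_nonneg (by linarith) (by positivity))]
  congr 1
  field_simp
  ring

theorem profile_profileShift (hk : k ∈ modulusRange) (hω : ω < 0) :
    profile k ω (profileShift k ω) = √(2 * |ω|) := by
  have h0 := pos_of_mem_modulusRange hk
  have h1 := two_mul_sq_sub_one_pos hk
  rw [profile, profileFreq_mul_profileShift hk hω, jacobiCn_shiftIntegral hk, profileAmp,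
    ← sqrt_mul (by positivity)]
  congr 1
  field_simp

theorem profileDeriv_profileShift_sq (hk : k ∈ modulusRange) (hω : ω < 0) :
    profileDeriv k ω (profileShift k ω) ^ 2 =
      2 * ω ^ 2 * k ^ 2 * (1 - k ^ 2) / (2 * k ^ 2 - 1) ^ 2 := by
  have h0 := pos_of_mem_modulusRange hk
  have h1 := two_mul_sq_sub_one_pos hk
  rw [profileDeriv, profileFreq_mul_profileShift hk hω, mul_pow, mul_pow, profileAmp_sq hk,
    profileFreq_sq hk, jacobiCnDeriv_sq (sq_lt_one_of_mem_modulusRange hk),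
    jacobiCn_shiftIntegral hk, sq_sqrt (by positivity), ← sq_abs ω]
  field_simp
  ring

-- In terms of `d = 2k² - 1` the equation reads `d² = ω² / (ω² + 2v²)`.
theorem exists_profileDeriv_profileShift_sq_eq (hω : ω < 0) {v : ℝ} (hv : v ≠ 0) :
    ∃ k ∈ modulusRange, profileDeriv k ω (profileShift k ω) ^ 2 = v ^ 2 := by
  have hω0 := hω.ne
  have hv2 : 0 < v ^ 2 := by positivity
  set d := √(ω ^ 2 / (ω ^ 2 + 2 * v ^ 2))
  have hd0 : 0 < d := sqrt_pos.2 (by positivity)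
  have hdsq : d ^ 2 = ω ^ 2 / (ω ^ 2 + 2 * v ^ 2) := sq_sqrt (by positivity)
  have hd1 : d < 1 := (sqrt_lt' one_pos).2 (by rw [div_lt_iff₀ (by positivity)]; linarith)
  have hksq : √((1 + d) / 2) ^ 2 = (1 + d) / 2 := sq_sqrt (by positivity)
  have hk : √((1 + d) / 2) ∈ modulusRange :=
    mem_modulusRange_iff.2 ⟨by positivity, by linarith, by linarith⟩
  refine ⟨_, hk, ?_⟩
  calc _ = ω ^ 2 * (1 - d ^ 2) / (2 * d ^ 2) := by
        rw [profileDeriv_profileShift_sq hk hω, hksq,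
          show 2 * ((1 + d) / 2) - 1 = d by ring, div_eq_div_iff (by positivity) (by positivity)]
        ring
    _ = v ^ 2 := by
        rw [hdsq]
        field_simp
        ring

theorem exists_modulus_phase (hω : ω < 0) {v : ℝ} (hv : v ≠ 0) :
    ∃ k ∈ modulusRange, ∃ s, |s| = profileShift k ω ∧ profile k ω s = √(2 * |ω|) ∧
      profileDeriv k ω s = v := by
  obtain ⟨k, hk, hsq⟩ := exists_profileDeriv_profileShift_sq_eq hω hv
  have hheight := profile_profileShift hk hω
  have hshift : |profileShift k ω| = profileShift k ω :=
    abs_of_pos (div_pos (shiftIntegral_pos hk) (profileFreq_pos hk hω))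
  rcases sq_eq_sq_iff_eq_or_eq_neg.1 hsq with h | h
  · exact ⟨k, hk, _, hshift, hheight, h⟩
  · refine ⟨k, hk, -profileShift k ω, by rwa [abs_neg], by rwa [profile_neg hk], ?_⟩
    rw [profileDeriv_neg hk, h, neg_neg]

end Profile

/-! ### The cnoidal wave of period `L / n` -/

section Cnoidal

variable {L ω : ℝ} {n : ℕ}

theorem mul_sqrt_div_pos (hL : 0 < L) (hn : 1 ≤ n) (hω : ω < 0) : 0 < L * √|ω| / n := by
  have hω' := abs_pos.2 hω.ne
  positivity

theorem kMod_mem (hL : 0 < L) (hn : 1 ≤ n) (hω : ω < 0) : kMod L n ω ∈ modulusRange :=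
  SInv_mem (mul_sqrt_div_pos hL hn hω)

theorem S_kMod (hL : 0 < L) (hn : 1 ≤ n) (hω : ω < 0) : S (kMod L n ω) = L * √|ω| / n :=
  S_SInv (mul_sqrt_div_pos hL hn hω)

theorem profilePeriod_kMod (hL : 0 < L) (hn : 1 ≤ n) (hω : ω < 0) :
    profilePeriod (kMod L n ω) ω = L / n := by
  have hω' := abs_pos.2 hω.ne
  rw [profilePeriod_eq, S_kMod hL hn hω]
  field_simp

theorem kMod_eq_of_profilePeriod_eq {k : ℝ} (hω : ω < 0) (hk : k ∈ modulusRange)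
    (h : profilePeriod k ω = L / n) : kMod L n ω = k := by
  have hω' := abs_pos.2 hω.ne
  rw [profilePeriod_eq, div_eq_iff (by positivity)] at h
  rw [kMod, ← SInv_S hk, h, div_mul_eq_mul_div]

theorem cnoidal_eq_profile (L : ℝ) (n : ℕ) (ω : ℝ) :
    cnoidal L n ω = profile (kMod L n ω) ω := rfl

theorem gammaShift_eq (hL : 0 < L) (hn : 1 ≤ n) (hω : ω < 0) :
    gammaShift L n ω = phi (kMod L n ω) / 2 * (L / (2 * n)) := by
  have hshift : gammaShift L n ω = profileShift (kMod L n ω) ω := by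
    rw [gammaShift, profileShift, profileFreq, ← inv_div |ω|, sqrt_inv, inv_mul_eq_div]
  rw [hshift, profileShift_eq (kMod_mem hL hn hω), profilePeriod_kMod hL hn hω]
  ring

end Cnoidal

/-! ### Weak derivatives -/

section WeakDeriv

open scoped Distributions ContDiff

/-- The open interval `(a, b)` as a bundled open set, the domain of Mathlib's test functions. -/
abbrev openInterval (a b : ℝ) : TopologicalSpace.Opens ℝ := ⟨Ioo a b, isOpen_Ioo⟩

variable {a b : ℝ}

theorem testFunction_eq_zero (η : 𝓓(openInterval a b, ℝ)) {x : ℝ} (hx : x ∉ Ioo a b) : η x = 0 :=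
  image_eq_zero_of_notMem_tsupport fun h => hx (η.tsupport_subset h)

theorem integrableOn_mul_testFunction {g : ℝ → ℝ} (hg : IntegrableOn g (Ioo a b))
    (η : 𝓓(openInterval a b, ℝ)) : IntegrableOn (fun x => g x * η x) (Ioo a b) := by
  obtain ⟨C, hC⟩ := η.hasCompactSupport.exists_bound_of_continuous η.continuous
  exact Integrable.mul_bdd hg η.continuous.aestronglyMeasurable (Filter.Eventually.of_forall hC)

theorem integrableOn_testFunction (η : 𝓓(openInterval a b, ℝ)) : IntegrableOn η (Ioo a b) :=
  (η.continuous.integrable_of_hasCompactSupport η.hasCompactSupport).integrableOn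

theorem exists_Icc_of_isCompact_subset_Ioo (hab : a < b) {K : Set ℝ} (hK : IsCompact K)
    (hKs : K ⊆ Ioo a b) : ∃ c d, a < c ∧ d < b ∧ K ⊆ Icc c d := by
  rcases K.eq_empty_or_nonempty with rfl | hne
  · obtain ⟨c, hac, hcb⟩ := exists_between hab
    exact ⟨c, c, hac, hcb, empty_subset _⟩
  · exact ⟨sInf K, sSup K, (hKs (hK.sInf_mem hne)).1, (hKs (hK.sSup_mem hne)).2,
      fun x hx => ⟨csInf_le hK.bddBelow hx, le_csSup hK.bddAbove hx⟩⟩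

theorem tsupport_primitive_subset {c d : ℝ} {ψ : ℝ → ℝ} (hac : a < c)
    (hψ : Function.support ψ ⊆ Icc c d) (h0 : ∫ x, ψ x = 0) :
    tsupport (fun x => ∫ t in a..x, ψ t) ⊆ Icc c d := by
  refine closure_minimal (fun x hx => ?_) isClosed_Icc
  by_contra hxcd
  refine hx ?_
  rcases lt_or_ge x c with hxc | hcx
  · refine intervalIntegral.integral_zero_ae (Filter.Eventually.of_forall fun t ht => ?_)
    by_contra hne
    exact (ht.2.trans_lt (max_lt hac hxc)).not_ge (hψ hne).1
  · have hdx : d < x := not_le.1 fun hxd => hxcd ⟨hcx, hxd⟩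
    dsimp only
    rw [← h0]
    exact intervalIntegral.integral_eq_integral_of_support_subset fun t ht =>
      ⟨hac.trans_le (hψ ht).1, (hψ ht).2.trans hdx.le⟩

theorem exists_testFunction_deriv_eq (hab : a < b) (ψ : 𝓓(openInterval a b, ℝ))
    (h0 : ∫ x, ψ x = 0) : ∃ η : 𝓓(openInterval a b, ℝ), deriv η = ψ := by
  obtain ⟨c, d, hac, hdb, hsub⟩ :=
    exists_Icc_of_isCompact_subset_Ioo hab ψ.hasCompactSupport ψ.tsupport_subset
  have hderiv : ∀ x, HasDerivAt (fun x => ∫ t in a..x, ψ t) (ψ x) x := fun x =>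
    ψ.continuous.integral_hasStrictDerivAt a x |>.hasDerivAt
  have hderiv' : deriv (fun x => ∫ t in a..x, ψ t) = ψ := funext fun x => (hderiv x).deriv
  have hsupp := tsupport_primitive_subset hac ((subset_tsupport ψ).trans hsub) h0
  exact ⟨⟨fun x => ∫ t in a..x, ψ t,
    contDiff_infty_iff_deriv.2
      ⟨fun x => (hderiv x).differentiableAt, by rw [hderiv']; exact ψ.contDiff⟩,
    isCompact_Icc.of_isClosed_subset (isClosed_tsupport _) hsupp,
    hsupp.trans (Icc_subset_Ioo hac hdb)⟩, hderiv'⟩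

theorem exists_testFunction_integral_eq_one (hab : a < b) :
    ∃ η : 𝓓(openInterval a b, ℝ), ∫ x, η x = 1 := by
  let β : ContDiffBump ((a + b) / 2) :=
    ⟨(b - a) / 8, (b - a) / 4, by linarith, by linarith⟩
  refine ⟨⟨β.normed volume, β.contDiff_normed, β.hasCompactSupport_normed, ?_⟩, β.integral_normed⟩
  rw [β.tsupport_normed_eq, closedBall_eq_Icc]
  exact Icc_subset_Ioo (by dsimp only [β]; linarith) (by dsimp only [β]; linarith)

theorem setIntegral_mul_testFunction (g : ℝ → ℝ) (η : 𝓓(openInterval a b, ℝ)) :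
    ∫ x in Ioo a b, g x * η x = ∫ x, g x * η x :=
  setIntegral_eq_integral_of_forall_compl_eq_zero fun x hx => by
    rw [testFunction_eq_zero η hx, mul_zero]

theorem ae_eq_of_forall_testFunction {g : ℝ → ℝ} {c : ℝ} (hg : IntegrableOn g (Ioo a b))
    (h : ∀ ψ : 𝓓(openInterval a b, ℝ), ∫ x in Ioo a b, g x * ψ x = c * ∫ x, ψ x) :
    ∀ᵐ x ∂(volume.restrict (Ioo a b)), g x = c := by
  have hgc : IntegrableOn (fun x => g x - c) (Ioo a b) := hg.sub (integrableOn_const (by simp))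
  rw [ae_restrict_iff' measurableSet_Ioo]
  have hae := isOpen_Ioo.ae_eq_zero_of_integral_contDiff_smul_eq_zero (μ := volume)
    hgc.locallyIntegrableOn fun ψ hψ hψc hψs => ?_
  · filter_upwards [hae] with x hx hmem using sub_eq_zero.1 (hx hmem)
  let ψ' : 𝓓(openInterval a b, ℝ) := ⟨ψ, hψ, hψc, hψs⟩
  calc ∫ x, ψ x • (g x - c) = ∫ x in Ioo a b, (g x - c) * ψ' x := by
        rw [setIntegral_mul_testFunction]
        exact integral_congr_ae (Filter.Eventually.of_forall fun x => mul_comm _ _)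
    _ = (∫ x in Ioo a b, g x * ψ' x) - ∫ x in Ioo a b, c * ψ' x := by
        rw [← integral_sub (integrableOn_mul_testFunction hg ψ')
          ((integrableOn_testFunction ψ').const_mul c)]
        simp only [sub_mul]
    _ = 0 := by
        rw [h ψ', setIntegral_mul_testFunction, integral_const_mul, sub_self]

/-- The lemma of du Bois-Reymond. -/
theorem exists_ae_eq_const_of_integral_mul_deriv_eq_zero (hab : a < b) {g : ℝ → ℝ}
    (hg : IntegrableOn g (Ioo a b))
    (h : ∀ η : 𝓓(openInterval a b, ℝ), ∫ x in Ioo a b, g x * deriv η x = 0) :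
    ∃ c : ℝ, ∀ᵐ x ∂(volume.restrict (Ioo a b)), g x = c := by
  obtain ⟨η₀, hη₀⟩ := exists_testFunction_integral_eq_one hab
  refine ⟨∫ x in Ioo a b, g x * η₀ x, ae_eq_of_forall_testFunction hg fun ψ => ?_⟩
  have hψ := ψ.continuous.integrable_of_hasCompactSupport (μ := volume) ψ.hasCompactSupport
  have hη₀' := η₀.continuous.integrable_of_hasCompactSupport (μ := volume) η₀.hasCompactSupport
  have hmean : ∫ x, (ψ - (∫ y, ψ y) • η₀) x = 0 := by
    change ∫ x, ψ x - (∫ y, ψ y) * η₀ x = 0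
    rw [integral_sub hψ (hη₀'.const_mul _), integral_const_mul, hη₀, mul_one, sub_self]
  obtain ⟨η, hη⟩ := exists_testFunction_deriv_eq hab _ hmean
  have hzero : ∫ x in Ioo a b, (g x * ψ x - (∫ y, ψ y) * (g x * η₀ x)) = 0 := by
    rw [← h η, hη]
    refine integral_congr_ae (Filter.Eventually.of_forall fun x => ?_)
    change g x * ψ x - (∫ y, ψ y) * (g x * η₀ x) = g x * (ψ x - (∫ y, ψ y) * η₀ x)
    ring
  rw [integral_sub (integrableOn_mul_testFunction hg ψ)
    ((integrableOn_mul_testFunction hg η₀).const_mul _), integral_const_mul, sub_eq_zero] at hzero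
  rw [hzero, mul_comm]

variable {L : ℝ}

theorem isWeakDeriv_of_hasDerivAt (hL : 0 ≤ L) {u v : ℝ → ℝ}
    (h : ∀ x, HasDerivAt u (v x) x) (hv : Continuous v) : IsWeakDeriv L u v := by
  intro η hη _ hs
  have hηd : ∀ x, HasDerivAt η (deriv η x) x := fun x =>
    (hη.differentiable (by simp) x).hasDerivAt
  have hη' : Continuous (deriv η) := hη.continuous_deriv (by simp)
  have hη0 : η 0 = 0 := image_eq_zero_of_notMem_tsupport fun h => (hs h).1.false
  have hηL : η L = 0 := image_eq_zero_of_notMem_tsupport fun h => (hs h).2.false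
  have hparts := intervalIntegral.integral_mul_deriv_eq_deriv_mul (a := 0) (b := L)
    (fun x _ => h x) (fun x _ => hηd x) (hv.intervalIntegrable _ _) (hη'.intervalIntegrable _ _)
  rwa [hη0, hηL, mul_zero, mul_zero, sub_zero, zero_sub, intervalIntegral.integral_of_le hL,
    intervalIntegral.integral_of_le hL, integral_Ioc_eq_integral_Ioo,
    integral_Ioc_eq_integral_Ioo] at hparts

theorem IsWeakDeriv.integral_sub_mul_deriv_eq_zero {u v U V : ℝ → ℝ}
    (hu : IntegrableOn u (Ioo 0 L)) (h : IsWeakDeriv L u v)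
    (hU : IntegrableOn U (Ioo 0 L)) (H : IsWeakDeriv L U V)
    (hV : ∀ᵐ x ∂(volume.restrict (Ioo 0 L)), v x = V x) (η : 𝓓(openInterval 0 L, ℝ)) :
    ∫ x in Ioo 0 L, (u x - U x) * deriv η x = 0 := by
  have hη' : Continuous (deriv η) := η.contDiff.continuous_deriv (by simp)
  obtain ⟨C, hC⟩ := η.hasCompactSupport.deriv.exists_bound_of_continuous hη'
  have hint : ∀ {g : ℝ → ℝ}, IntegrableOn g (Ioo 0 L) →
      IntegrableOn (fun x => g x * deriv η x) (Ioo 0 L) := fun hg =>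
    Integrable.mul_bdd hg hη'.aestronglyMeasurable (Filter.Eventually.of_forall hC)
  have hvV : ∫ x in Ioo 0 L, v x * η x = ∫ x in Ioo 0 L, V x * η x :=
    integral_congr_ae (hV.mono fun x hx => by simp only [hx])
  simp only [sub_mul]
  rw [integral_sub (hint hu) (hint hU),
    h η η.contDiff η.hasCompactSupport η.tsupport_subset,
    H η η.contDiff η.hasCompactSupport η.tsupport_subset, hvV, sub_self]

theorem exists_hasDerivAt_of_isWeakDeriv (hL : 0 < L) {u v V : ℝ → ℝ}
    (hu : IntegrableOn u (Ioo 0 L)) (h : IsWeakDeriv L u v) (hV : Continuous V)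
    (hvV : ∀ᵐ x ∂(volume.restrict (Ioo 0 L)), v x = V x) :
    ∃ U : ℝ → ℝ, (∀ x, HasDerivAt U (V x) x) ∧
      ∀ᵐ x ∂(volume.restrict (Ioo 0 L)), u x = U x := by
  have hF : ∀ x, HasDerivAt (fun x => ∫ t in (0 : ℝ)..x, V t) (V x) x := fun x =>
    (hV.integral_hasStrictDerivAt 0 x).hasDerivAt
  have hFc : Continuous fun x => ∫ t in (0 : ℝ)..x, V t :=
    continuous_iff_continuousAt.2 fun x => (hF x).continuousAt
  have hFi : IntegrableOn (fun x => ∫ t in (0 : ℝ)..x, V t) (Ioo 0 L) :=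
    hFc.continuousOn.integrableOn_Icc.mono_set Ioo_subset_Icc_self
  obtain ⟨c, hc⟩ := exists_ae_eq_const_of_integral_mul_deriv_eq_zero hL (hu.sub hFi)
    (h.integral_sub_mul_deriv_eq_zero hu hFi (isWeakDeriv_of_hasDerivAt hL.le hF hV) hvV)
  exact ⟨_, fun x => (hF x).add_const c, hc.mono fun x hx => sub_eq_iff_eq_add'.1 hx⟩

end WeakDeriv

/-! ### Classical solutions -/

section ClassicalSolution

variable {L ω : ℝ} {u v u' v' : ℝ → ℝ}

/-- `u` is a classical solution of `-u'' - u³ = ω u` on `[0, L]` with `u' = v`, written as a first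
order system. -/
def IsClassicalSolution (L ω : ℝ) (u v : ℝ → ℝ) : Prop :=
  ∀ x ∈ Icc 0 L, HasDerivWithinAt u (v x) (Icc 0 L) x ∧
    HasDerivWithinAt v (-(ω * u x) - u x ^ 3) (Icc 0 L) x

theorem isClassicalSolution_of_hasDerivAt (L : ℝ) (hu : ∀ x, HasDerivAt u (v x) x)
    (hv : ∀ x, HasDerivAt v (-(ω * u x) - u x ^ 3) x) : IsClassicalSolution L ω u v :=
  fun x _ => ⟨(hu x).hasDerivWithinAt, (hv x).hasDerivWithinAt⟩

theorem IsClassicalSolution.derivWithin_eq (hL : 0 < L) (h : IsClassicalSolution L ω u v) {x : ℝ}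
    (hx : x ∈ Icc 0 L) : derivWithin u (Icc 0 L) x = v x :=
  (h x hx).1.derivWithin (uniqueDiffOn_Icc hL x hx)

theorem SolvesNLS.exists_isClassicalSolution (hL : 0 < L) (hu : ContinuousOn u (Icc 0 L))
    (h : SolvesNLS L ω u) : ∃ v, IsClassicalSolution L ω u v := by
  obtain ⟨v, w, hH2, heq⟩ := h
  let f : ℝ → ℝ := IccExtend hL.le ((Icc 0 L).domRestrict fun x => -(ω * u x) - u x ^ 3)
  have hf : Continuous f :=
    (ContinuousOn.domRestrict (f := fun x => -(ω * u x) - u x ^ 3) (by fun_prop)).Icc_extend'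
  have hf_eq : ∀ x ∈ Icc 0 L, f x = -(ω * u x) - u x ^ 3 := fun x hx =>
    IccExtend_of_mem hL.le _ hx
  have hwf : ∀ᵐ x ∂(volume.restrict (Ioo 0 L)), w x = f x := by
    filter_upwards [heq, ae_restrict_mem measurableSet_Ioo] with x hx hmem
    rw [hf_eq x (Ioo_subset_Icc_self hmem)]
    linarith
  obtain ⟨V, hV, hvV⟩ := exists_hasDerivAt_of_isWeakDeriv hL
    (hH2.memLp_fst.integrable one_le_two) hH2.weakDeriv_snd hf hwf
  have hVc : Continuous V := continuous_iff_continuousAt.2 fun x => (hV x).continuousAt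
  obtain ⟨U, hU, huU⟩ := exists_hasDerivAt_of_isWeakDeriv hL
    (hH2.memLp.integrable one_le_two) hH2.weakDeriv_fst hVc hvV
  have hUc : Continuous U := continuous_iff_continuousAt.2 fun x => (hU x).continuousAt
  have hEq : EqOn u U (Icc 0 L) := Measure.eqOn_Icc_of_ae_eq volume hL.ne
    (by rwa [← restrict_Ioo_eq_restrict_Icc]) hu hUc.continuousOn
  refine ⟨V, fun x hx => ⟨(hU x).hasDerivWithinAt.congr hEq (hEq hx), ?_⟩⟩
  exact (hV x).hasDerivWithinAt.congr_deriv (hf_eq x hx)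

theorem memLp_restrict_Ioo_of_continuous (hu : Continuous u) (p : ENNReal) :
    MemLp u p (volume.restrict (Ioo 0 L)) := by
  obtain ⟨C, hC⟩ := isCompact_Icc.exists_bound_of_continuousOn (s := Icc 0 L) hu.continuousOn
  exact MemLp.of_bound hu.aestronglyMeasurable C (ae_restrict_of_forall_mem measurableSet_Ioo
    fun x hx => hC x (Ioo_subset_Icc_self hx))

theorem isH2With_of_hasDerivAt (hL : 0 ≤ L) {w : ℝ → ℝ} (hu : ∀ x, HasDerivAt u (v x) x)
    (hv : ∀ x, HasDerivAt v (w x) x) (hw : Continuous w) : IsH2With L u v w := by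
  have huc : Continuous u := continuous_iff_continuousAt.2 fun x => (hu x).continuousAt
  have hvc : Continuous v := continuous_iff_continuousAt.2 fun x => (hv x).continuousAt
  exact ⟨memLp_restrict_Ioo_of_continuous huc 2, memLp_restrict_Ioo_of_continuous hvc 2,
    memLp_restrict_Ioo_of_continuous hw 2, isWeakDeriv_of_hasDerivAt hL hu hvc,
    isWeakDeriv_of_hasDerivAt hL hv hw⟩

theorem solvesP_of_hasDerivAt {ε L₁ : ℝ} (hL : 0 < L) (hω : ω < 0)
    (hu : ∀ x, HasDerivAt u (v x) x) (hv : ∀ x, HasDerivAt v (-(ω * u x) - u x ^ 3) x)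
    (huL : u 0 = u L) (hvL : v 0 = v L) (h0 : u 0 = √(2 * |ω|)) (h1 : ε * u L₁ = √(2 * |ω|)) :
    SolvesP ε L L₁ ω u := by
  have huc : Continuous u := continuous_iff_continuousAt.2 fun x => (hu x).continuousAt
  have hH2 := isH2With_of_hasDerivAt hL.le hu hv (by fun_prop)
  have hclass := isClassicalSolution_of_hasDerivAt L hu hv
  refine ⟨hω, ⟨huc.continuousOn, ⟨_, _, hH2⟩, huL, ?_⟩, ⟨_, _, hH2, ?_⟩, h0, h1⟩
  · rw [hclass.derivWithin_eq hL (left_mem_Icc.2 hL.le),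
      hclass.derivWithin_eq hL (right_mem_Icc.2 hL.le), hvL]
  · exact Filter.Eventually.of_forall fun x => by ring

theorem IsClassicalSolution.continuousOn_prodMk (h : IsClassicalSolution L ω u v) :
    ContinuousOn (fun x => (u x, v x)) (Icc 0 L) := fun x hx =>
  (h x hx).1.continuousWithinAt.prodMk (h x hx).2.continuousWithinAt

theorem IsClassicalSolution.hasDerivWithinAt_prodMk (h : IsClassicalSolution L ω u v) {x : ℝ}
    (hx : x ∈ Ico 0 L) :
    HasDerivWithinAt (fun x => (u x, v x)) (v x, -(ω * u x) - u x ^ 3) (Ici x) x := by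
  have hx' := h x (Ico_subset_Icc_self hx)
  exact (hx'.1.prodMk hx'.2).mono_of_mem_nhdsWithin
    (Filter.mem_of_superset (Icc_mem_nhdsGE hx.2) (Icc_subset_Icc_left hx.1))

theorem IsClassicalSolution.eqOn (h : IsClassicalSolution L ω u v)
    (h' : IsClassicalSolution L ω u' v') (hu : u 0 = u' 0) (hv : v 0 = v' 0) :
    EqOn u u' (Icc 0 L) ∧ EqOn v v' (Icc 0 L) := by
  have hfield : ContDiff ℝ 1 fun p : ℝ × ℝ => (p.2, -(ω * p.1) - p.1 ^ 3) := by fun_prop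
  have hc := h.continuousOn_prodMk
  have hc' := h'.continuousOn_prodMk
  obtain ⟨K, hK⟩ := (hfield.locallyLipschitz.locallyLipschitzOn
    (s := (fun x => (u x, v x)) '' Icc 0 L ∪ (fun x => (u' x, v' x)) '' Icc 0 L)
    ).exists_lipschitzOnWith_of_compact
      ((isCompact_Icc.image_of_continuousOn hc).union (isCompact_Icc.image_of_continuousOn hc'))
  have huniq := ODE_solution_unique_of_mem_Icc_right (fun _ _ => hK)
    hc (fun t ht => h.hasDerivWithinAt_prodMk ht)
    (fun t ht => Or.inl ⟨t, Ico_subset_Icc_self ht, rfl⟩)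
    hc' (fun t ht => h'.hasDerivWithinAt_prodMk ht)
    (fun t ht => Or.inr ⟨t, Ico_subset_Icc_self ht, rfl⟩) (by simp only [hu, hv])
  exact ⟨fun x hx => congrArg Prod.fst (huniq hx), fun x hx => congrArg Prod.snd (huniq hx)⟩

end ClassicalSolution

/-! ### Classification of the periodic solutions -/

section Classification

variable {L ω k : ℝ} {u v : ℝ → ℝ}

theorem isClassicalSolution_sech (L a : ℝ) :
    IsClassicalSolution L (-a ^ 2) (fun x => √2 * a / cosh (a * x))
      (fun x => -(√2 * a ^ 2 * sinh (a * x)) / cosh (a * x) ^ 2) := by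
  have hlin (x : ℝ) : HasDerivAt (fun x => a * x) a x := by
    simpa using (hasDerivAt_id x).const_mul a
  have hne (x : ℝ) : cosh (a * x) ≠ 0 := (cosh_pos _).ne'
  refine isClassicalSolution_of_hasDerivAt L (fun x => ?_) (fun x => ?_)
  · refine ((hasDerivAt_const x (√2 * a)).div (hlin x).cosh (hne x)).congr_deriv ?_
    ring
  · refine (((hlin x).sinh.const_mul (√2 * a ^ 2)).neg.div ((hlin x).cosh.pow 2)
      (pow_ne_zero 2 (hne x))).congr_deriv ?_
    have hx := hne x
    have h2 : √2 ^ 2 = 2 := sq_sqrt zero_le_two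
    simp only [Pi.pow_apply, Pi.neg_apply]
    field_simp
    push_cast
    linear_combination a ^ 3 * cosh (a * x) * h2 - 2 * a ^ 3 * cosh (a * x) * cosh_sq (a * x)

theorem isClassicalSolution_profile (hk : k ∈ modulusRange) (hω : ω < 0) (s : ℝ) :
    IsClassicalSolution L ω (fun x => profile k ω (x + s)) (fun x => profileDeriv k ω (x + s)) :=
  isClassicalSolution_of_hasDerivAt L
    (fun x => HasDerivAt.comp_add_const x s (hasDerivAt_profile hk (x + s)))
    (fun x => HasDerivAt.comp_add_const x s (hasDerivAt_profileDeriv hk hω (x + s)))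

/- `√(2|ω|)` is the maximum of the solitary wave, so a solution starting there with slope zero is
the solitary wave, which does not return. -/
theorem IsClassicalSolution.deriv_zero_ne_zero (h : IsClassicalSolution L ω u v) (hL : 0 < L)
    (hω : ω < 0) (h0 : u 0 = √(2 * |ω|)) (hu : u 0 = u L) : v 0 ≠ 0 := by
  intro hv0
  obtain ⟨a, ha, rfl⟩ : ∃ a, 0 < a ∧ ω = -a ^ 2 :=
    ⟨√(-ω), sqrt_pos.2 (neg_pos.2 hω), by rw [sq_sqrt (neg_pos.2 hω).le, neg_neg]⟩
  have hmax : u 0 = √2 * a := by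
    rw [h0, abs_neg, abs_of_pos (by positivity), sqrt_mul zero_le_two, sqrt_sq ha.le]
  have hsech := (h.eqOn (isClassicalSolution_sech L a) (by simp [hmax]) (by simp [hv0])).1
    (right_mem_Icc.2 hL.le)
  have hlt : √2 * a / cosh (a * L) < √2 * a :=
    div_lt_self (by positivity) (one_lt_cosh.2 (mul_pos ha hL).ne')
  exact hlt.ne (hsech.symm.trans (hu.symm.trans hmax))

theorem exists_profilePeriod_eq_div (hk : k ∈ modulusRange) (hω : ω < 0) (hL : 0 < L) {s : ℝ}
    (h : profile k ω s = profile k ω (L + s))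
    (h' : profileDeriv k ω s = profileDeriv k ω (L + s)) :
    ∃ n : ℕ, 1 ≤ n ∧ profilePeriod k ω = L / n := by
  obtain ⟨m, hm⟩ := eq_add_period_of_profile_eq hk hω h h'
  have hmT : m * profilePeriod k ω = L := by linarith
  have hm0 : 0 < m := by
    exact_mod_cast pos_of_mul_pos_left (hmT.symm ▸ hL) (profilePeriod_pos hk hω).le
  lift m to ℕ using hm0.le
  have hn : 0 < m := by exact_mod_cast hm0
  refine ⟨m, hn, ?_⟩
  rw [eq_div_iff (by positivity), mul_comm]
  exact_mod_cast hmT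

/-- The cnoidal wave of period `L / n` and frequency `ω`, shifted to the left by `t` half
periods. -/
noncomputable def shiftedCnoidal (L : ℝ) (n : ℕ) (ω t x : ℝ) : ℝ :=
  cnoidal L n ω (x + t * (L / (2 * n)))

theorem IsClassicalSolution.exists_eqOn_shiftedCnoidal (h : IsClassicalSolution L ω u v)
    (hL : 0 < L) (hω : ω < 0) (h0 : u 0 = √(2 * |ω|)) (hu : u 0 = u L) (hv : v 0 = v L) :
    ∃ n : ℕ, 1 ≤ n ∧ ∃ t, |t| = phi (kMod L n ω) / 2 ∧
      EqOn u (shiftedCnoidal L n ω t) (Icc 0 L) := by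
  obtain ⟨k, hk, s, hs, hus, hvs⟩ := exists_modulus_phase hω (h.deriv_zero_ne_zero hL hω h0 hu)
  obtain ⟨hEqu, hEqv⟩ := h.eqOn (isClassicalSolution_profile hk hω s) (by simp [h0, hus])
    (by simp [hvs])
  have hLmem : L ∈ Icc 0 L := right_mem_Icc.2 hL.le
  obtain ⟨n, hn, hT⟩ := exists_profilePeriod_eq_div hk hω hL
    (by rw [hus, ← h0, hu]; exact hEqu hLmem) (by rw [hvs, hv]; exact hEqv hLmem)
  have hkMod : kMod L n ω = k := kMod_eq_of_profilePeriod_eq hω hk hT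
  refine ⟨n, hn, s / (L / (2 * n)), ?_, fun x hx => ?_⟩
  · rw [abs_div, hs, profileShift_eq hk, hT, abs_of_pos (by positivity), hkMod]
    field_simp
    norm_num
  · rw [hEqu hx, shiftedCnoidal, cnoidal_eq_profile, hkMod, div_mul_cancel₀ _ (by positivity)]

theorem SolvesP.exists_eqOn_shiftedCnoidal {ε L₁ : ℝ} (h : SolvesP ε L L₁ ω u) (hL : 0 < L) :
    ∃ n : ℕ, 1 ≤ n ∧ ∃ t, |t| = phi (kMod L n ω) / 2 ∧
      EqOn u (shiftedCnoidal L n ω t) (Icc 0 L) := by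
  obtain ⟨v, hv⟩ := h.eqn.exists_isClassicalSolution hL h.mem.continuousOn
  refine hv.exists_eqOn_shiftedCnoidal hL h.neg h.left h.mem.periodic ?_
  rw [← hv.derivWithin_eq hL (left_mem_Icc.2 hL.le), h.mem.periodic_deriv,
    hv.derivWithin_eq hL (right_mem_Icc.2 hL.le)]

end Classification

/-! ### The boundary conditions as congruences -/

section BoundaryConditions

variable {ε L L₁ ω t : ℝ} {n : ℕ}

theorem shiftedCnoidal_zero (hL : 0 < L) (hn : 1 ≤ n) (hω : ω < 0)
    (ht : |t| = phi (kMod L n ω) / 2) : shiftedCnoidal L n ω t 0 = √(2 * |ω|) := by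
  have hk := kMod_mem hL hn hω
  have hγ : |t| * (L / (2 * n)) = profileShift (kMod L n ω) ω := by
    rw [ht, profileShift_eq hk, profilePeriod_kMod hL hn hω]
    ring
  rw [shiftedCnoidal, zero_add, cnoidal_eq_profile, ← profile_profileShift hk hω, ← hγ]
  rcases abs_choice t with h | h
  · rw [h]
  · rw [h, neg_mul, profile_neg hk]

theorem solvesP_shiftedCnoidal (hL : 0 < L) (hn : 1 ≤ n) (hω : ω < 0)
    (ht : |t| = phi (kMod L n ω) / 2) (h : ε * shiftedCnoidal L n ω t L₁ = √(2 * |ω|)) :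
    SolvesP ε L L₁ ω (shiftedCnoidal L n ω t) := by
  have hk := kMod_mem hL hn hω
  have hn0 : (n : ℝ) ≠ 0 := by positivity
  have heq : shiftedCnoidal L n ω t =
      fun x => profile (kMod L n ω) ω (x + t * (L / (2 * n))) := by
    funext x
    rw [shiftedCnoidal, cnoidal_eq_profile]
  have hreturn : L + t * (L / (2 * n)) =
      0 + t * (L / (2 * n)) + (n : ℤ) * (2 * (profilePeriod (kMod L n ω) ω / 2)) := by
    rw [profilePeriod_kMod hL hn hω]
    push_cast
    field_simp
    ring
  have h0 := shiftedCnoidal_zero hL hn hω ht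
  rw [heq] at h h0 ⊢
  refine solvesP_of_hasDerivAt hL hω
    (fun x => HasDerivAt.comp_add_const x _ (hasDerivAt_profile hk _))
    (fun x => HasDerivAt.comp_add_const x _ (hasDerivAt_profileDeriv hk hω _)) ?_ ?_ h0 h
  · rw [hreturn]
    exact ((profile_antiperiodic hk hω).periodic_two_mul.int_mul n _).symm
  · rw [hreturn]
    exact ((profileDeriv_antiperiodic hk hω).periodic_two_mul.int_mul n _).symm

theorem neg_shiftedCnoidal (hL : 0 < L) (hn : 1 ≤ n) (hω : ω < 0) (x : ℝ) :
    -shiftedCnoidal L n ω t x = shiftedCnoidal L n ω t (x + L / (2 * n)) := by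
  have hhalf : L / (2 * n) = profilePeriod (kMod L n ω) ω / 2 := by
    rw [profilePeriod_kMod hL hn hω]
    ring
  rw [shiftedCnoidal, shiftedCnoidal, cnoidal_eq_profile, add_right_comm, hhalf,
    profile_antiperiodic (kMod_mem hL hn hω) hω]

theorem shiftedCnoidal_eq_iff (hL : 0 < L) (hn : 1 ≤ n) (hω : ω < 0)
    (ht : |t| = phi (kMod L n ω) / 2) {x : ℝ} :
    shiftedCnoidal L n ω t x = √(2 * |ω|) ↔
      (∃ m : ℤ, x / L * n = m) ∨ ∃ m : ℤ, x / L * n + t = m := by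
  rw [← shiftedCnoidal_zero hL hn hω ht, shiftedCnoidal, shiftedCnoidal, cnoidal_eq_profile,
    eq_comm, profile_eq_iff (kMod_mem hL hn hω) hω, profilePeriod_kMod hL hn hω, exists_or]
  refine or_congr (exists_congr fun m => ?_) (exists_congr fun m => ?_)
  · rw [zero_add, add_comm x, add_right_inj, div_mul_eq_mul_div, div_eq_iff hL.ne',
      ← mul_div_assoc, eq_div_iff (by positivity)]
  · field_simp
    constructor <;> intro h <;> linarith

/-- The pair consisting of the frequency `ω` and the restriction of `shiftedCnoidal L n ω t`. -/
noncomputable def shiftedPair (L : ℝ) (n : ℕ) (ω t : ℝ) : ℝ × (Icc (0 : ℝ) L → ℝ) :=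
  (ω, onInterval L (shiftedCnoidal L n ω t))

theorem exists_solvesP_iff (hL₁ : 0 < L₁) (hL : L₁ < L) {z : ℝ × (Icc (0 : ℝ) L → ℝ)} :
    (∃ ω u, SolvesP ε L L₁ ω u ∧ z = (ω, onInterval L u)) ↔
      ∃ n : ℕ, 1 ≤ n ∧ ∃ ω < 0, ∃ t, |t| = phi (kMod L n ω) / 2 ∧
        ε * shiftedCnoidal L n ω t L₁ = √(2 * |ω|) ∧ z = shiftedPair L n ω t := by
  have hL0 := hL₁.trans hL
  constructor
  · rintro ⟨ω, u, hu, rfl⟩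
    obtain ⟨n, hn, t, ht, hEq⟩ := hu.exists_eqOn_shiftedCnoidal hL0
    refine ⟨n, hn, ω, hu.neg, t, ht, by rw [← hEq ⟨hL₁.le, hL.le⟩, hu.right], ?_⟩
    exact congrArg (Prod.mk ω) (funext fun x => hEq x.2)
  · rintro ⟨n, hn, ω, hω, t, ht, h, rfl⟩
    exact ⟨ω, _, solvesP_shiftedCnoidal hL0 hn hω ht h, rfl⟩

theorem mem_solutionsPplus_iff (hL₁ : 0 < L₁) (hL : L₁ < L) {z : ℝ × (Icc (0 : ℝ) L → ℝ)} :
    z ∈ solutionsPplus L L₁ ↔ ∃ n : ℕ, 1 ≤ n ∧ ∃ ω < 0, ∃ t, |t| = phi (kMod L n ω) / 2 ∧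
      ((∃ m : ℤ, L₁ / L * n = m) ∨ ∃ m : ℤ, L₁ / L * n + t = m) ∧ z = shiftedPair L n ω t := by
  refine (exists_solvesP_iff hL₁ hL).trans (exists_congr fun n => and_congr_right fun hn =>
    exists_congr fun ω => and_congr_right fun hω => exists_congr fun t =>
    and_congr_right fun ht => and_congr_left fun _ => ?_)
  rw [one_mul, shiftedCnoidal_eq_iff (hL₁.trans hL) hn hω ht]

theorem mem_solutionsPminus_iff (hL₁ : 0 < L₁) (hL : L₁ < L) {z : ℝ × (Icc (0 : ℝ) L → ℝ)} :
    z ∈ solutionsPminus L L₁ ↔ ∃ n : ℕ, 1 ≤ n ∧ ∃ ω < 0, ∃ t, |t| = phi (kMod L n ω) / 2 ∧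
      ((∃ m : ℤ, L₁ / L * n + 1 / 2 = m) ∨ ∃ m : ℤ, L₁ / L * n + 1 / 2 + t = m) ∧
      z = shiftedPair L n ω t := by
  have hL0 := hL₁.trans hL
  refine (exists_solvesP_iff hL₁ hL).trans (exists_congr fun n => and_congr_right fun hn =>
    exists_congr fun ω => and_congr_right fun hω => exists_congr fun t =>
    and_congr_right fun ht => and_congr_left fun _ => ?_)
  have hhalf : (L₁ + L / (2 * n)) / L * n = L₁ / L * n + 1 / 2 := by field_simp
  rw [neg_one_mul, neg_shiftedCnoidal hL0 hn hω, shiftedCnoidal_eq_iff hL0 hn hω ht, hhalf]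

theorem onInterval_uTilde_eq_iff (hL : 0 < L) (hn : 1 ≤ n) (hω : ω < 0)
    {z : ℝ × (Icc (0 : ℝ) L → ℝ)} :
    z = (ω, onInterval L (uTildePlus L n ω)) ∨ z = (ω, onInterval L (uTildeMinus L n ω)) ↔
      ∃ t, |t| = phi (kMod L n ω) / 2 ∧ z = shiftedPair L n ω t := by
  have hφ : 0 ≤ phi (kMod L n ω) / 2 := (half_pos (phi_mem_Ioo (kMod_mem hL hn hω)).1).le
  have hplus : uTildePlus L n ω = shiftedCnoidal L n ω (phi (kMod L n ω) / 2) := by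
    funext x
    rw [uTildePlus, gammaShift_eq hL hn hω, shiftedCnoidal]
  have hminus : uTildeMinus L n ω = shiftedCnoidal L n ω (-(phi (kMod L n ω) / 2)) := by
    funext x
    rw [uTildeMinus, gammaShift_eq hL hn hω, shiftedCnoidal, neg_mul, sub_eq_add_neg]
  simp only [hplus, hminus, abs_eq hφ, or_and_right, exists_or, exists_eq_left, shiftedPair]

theorem mem_branches_iff (hL : 0 < L) {A : Set ℕ} (hA : ∀ n ∈ A, 1 ≤ n)
    {z : ℝ × (Icc (0 : ℝ) L → ℝ)} :
    z ∈ branches L A ↔ ∃ n ∈ A, ∃ ω < 0, ∃ t, |t| = phi (kMod L n ω) / 2 ∧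
      z = shiftedPair L n ω t :=
  exists_congr fun _ => and_congr_right fun hn => exists_congr fun _ =>
    and_congr_right fun hω => onInterval_uTilde_eq_iff hL (hA _ hn) hω

theorem phi_kMod_eq_iff (hL : 0 < L) (hn : 1 ≤ n) (hω : ω < 0) {y : ℝ} (hy : y ∈ Ioo 0 1) :
    phi (kMod L n ω) = y ↔ ω = -((n / L * G y) ^ 2) := by
  have hk := kMod_mem hL hn hω
  have hG : 0 < G y := S_pos (phiInv_mem hy)
  calc phi (kMod L n ω) = y ↔ kMod L n ω = phiInv y :=
        ⟨fun h => by rw [← h, phiInv_phi hk], fun h => by rw [h, phi_phiInv hy]⟩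
    _ ↔ L * √|ω| / n = G y := by
        rw [← S_kMod hL hn hω, G, bijOn_S.injOn.eq_iff hk (phiInv_mem hy)]
    _ ↔ √|ω| = n / L * G y := by
        field_simp
    _ ↔ ω = -((n / L * G y) ^ 2) := by
        rw [sqrt_eq_iff_eq_sq (abs_nonneg _) (by positivity), abs_of_neg hω, neg_eq_iff_eq_neg]

theorem eq_shiftedPair_iff (hL : 0 < L) (hn : 1 ≤ n) (ht : 2 * |t| ∈ Ioo 0 1)
    {z : ℝ × (Icc (0 : ℝ) L → ℝ)} :
    z = shiftedPair L n (-((n / L * G (2 * |t|)) ^ 2)) t ↔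
      ∃ ω < 0, |t| = phi (kMod L n ω) / 2 ∧ z = shiftedPair L n ω t := by
  have hG : 0 < G (2 * |t|) := S_pos (phiInv_mem ht)
  constructor
  · intro h
    have hω : -((n / L * G (2 * |t|)) ^ 2) < 0 := neg_neg_of_pos (by positivity)
    refine ⟨_, hω, ?_, h⟩
    rw [(phi_kMod_eq_iff hL hn hω ht).2 rfl]
    ring
  · rintro ⟨ω, hω, hφ, h⟩
    rwa [← (phi_kMod_eq_iff hL hn hω ht).1 (by linarith)]

end BoundaryConditions

/-! ### The fractional parts -/

section FractionalPart

variable {L L₁ ω t : ℝ} {n : ℕ} {z : ℝ × (Icc (0 : ℝ) L → ℝ)}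

theorem exists_int_add_iff {x s : ℝ} (hs : ∃ m : ℤ, x + s = m) (hst : |t - s| < 1) :
    (∃ m : ℤ, x + t = m) ↔ t = s := by
  refine ⟨fun ⟨m, hm⟩ => ?_, fun h => h ▸ hs⟩
  obtain ⟨j, hj⟩ := hs
  have hdiff : t - s = ((m - j : ℤ) : ℝ) := by push_cast; linarith
  have hzero : m - j = 0 := Int.abs_lt_one_iff.1 (by rw [hdiff] at hst; exact_mod_cast hst)
  rw [hzero, Int.cast_zero] at hdiff
  exact sub_eq_zero.1 hdiff

theorem rSeq_mem_Ico (L L₁ : ℝ) (n : ℕ) : rSeq L L₁ n ∈ Ico (-(1 / 2)) (1 / 2) := by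
  have hle := Int.floor_le (L₁ / L * n + 1 / 2)
  have hlt := Int.lt_floor_add_one (L₁ / L * n + 1 / 2)
  constructor <;> rw [rSeq] <;> linarith

theorem exists_int_sub_rSeq (L L₁ : ℝ) (n : ℕ) : ∃ m : ℤ, L₁ / L * n + -rSeq L L₁ n = m :=
  ⟨_, by rw [rSeq]; ring⟩

theorem rSeq_eq_zero_iff : rSeq L L₁ n = 0 ↔ ∃ m : ℤ, L₁ / L * n = m := by
  obtain ⟨hle, hlt⟩ := rSeq_mem_Ico L L₁ n
  have h := exists_int_add_iff (t := 0) (exists_int_sub_rSeq L L₁ n)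
    (abs_lt.2 ⟨by linarith, by linarith⟩)
  rw [add_zero] at h
  rw [h, zero_eq_neg]

theorem rSeq_eq_neg_half_iff : rSeq L L₁ n = -(1 / 2) ↔ ∃ m : ℤ, L₁ / L * n + 1 / 2 = m := by
  obtain ⟨hle, hlt⟩ := rSeq_mem_Ico L L₁ n
  rw [exists_int_add_iff (exists_int_sub_rSeq L L₁ n) (abs_lt.2 ⟨by linarith, by linarith⟩),
    eq_neg_iff_add_eq_zero, eq_neg_iff_add_eq_zero, add_comm]

/-- The `n ≥ 1` with `ξ_n ∈ (0, 1)`, that is `r_n ∉ {0, -1/2}`. -/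
def isolatedIndices (L L₁ : ℝ) : Set ℕ := {n | 1 ≤ n ∧ rSeq L L₁ n ≠ 0 ∧ rSeq L L₁ n ≠ -(1 / 2)}

theorem xiSeq_mem_Ioo (hn : n ∈ isolatedIndices L L₁) : xiSeq L L₁ n ∈ Ioo 0 1 := by
  obtain ⟨-, h0, hhalf⟩ := hn
  obtain ⟨hle, hlt⟩ := rSeq_mem_Ico L L₁ n
  have habs : |rSeq L L₁ n| < 1 / 2 := abs_lt.2 ⟨lt_of_le_of_ne hle hhalf.symm, hlt⟩
  exact ⟨mul_pos two_pos (abs_pos.2 h0), by rw [xiSeq]; linarith⟩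

theorem two_mul_abs_neg_rSeq (L L₁ : ℝ) (n : ℕ) : 2 * |-rSeq L L₁ n| = xiSeq L L₁ n := by
  rw [abs_neg, xiSeq]

/-- The phase `(1/2 - |r_n|) sgn r_n = -(2n/L) s_n⁻` of `u_n⁻` in half periods; the phase of `u_n⁺`
is `-r_n`. -/
noncomputable def minusPhase (L L₁ : ℝ) (n : ℕ) : ℝ :=
  (1 / 2 - |rSeq L L₁ n|) * Real.sign (rSeq L L₁ n)

theorem two_mul_abs_minusPhase (h0 : rSeq L L₁ n ≠ 0) :
    2 * |minusPhase L L₁ n| = 1 - xiSeq L L₁ n := by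
  obtain ⟨hle, hlt⟩ := rSeq_mem_Ico L L₁ n
  have habs : |rSeq L L₁ n| ≤ 1 / 2 := abs_le.2 ⟨hle, hlt.le⟩
  have hsign : |Real.sign (rSeq L L₁ n)| = 1 := by
    rcases sign_apply_eq_of_ne_zero _ h0 with h | h <;> simp [h]
  rw [minusPhase, abs_mul, hsign, abs_of_nonneg (by linarith), xiSeq]
  ring

theorem exists_int_add_minusPhase (h0 : rSeq L L₁ n ≠ 0) :
    ∃ m : ℤ, L₁ / L * n + 1 / 2 + minusPhase L L₁ n = m := by
  obtain ⟨m, hm⟩ := exists_int_sub_rSeq L L₁ n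
  rcases h0.lt_or_gt with h | h
  · exact ⟨m, by rw [minusPhase, sign_of_neg h, abs_of_neg h, ← hm]; ring⟩
  · exact ⟨m + 1, by rw [minusPhase, sign_of_pos h, abs_of_pos h]; push_cast; rw [← hm]; ring⟩

theorem plus_congruence_iff (hn : 1 ≤ n) (ht : 2 * |t| ∈ Ioo 0 1) :
    ((∃ m : ℤ, L₁ / L * n = m) ∨ ∃ m : ℤ, L₁ / L * n + t = m) ↔
      rSeq L L₁ n = 0 ∨ n ∈ isolatedIndices L L₁ ∧ t = -rSeq L L₁ n := by
  obtain ⟨hle, hlt⟩ := rSeq_mem_Ico L L₁ n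
  obtain ⟨ht_neg, ht_pos⟩ := abs_lt.1 (show |t| < 1 / 2 by linarith [ht.2])
  rw [← rSeq_eq_zero_iff, exists_int_add_iff (exists_int_sub_rSeq L L₁ n)
    (abs_lt.2 ⟨by linarith, by linarith⟩)]
  have hindex : t = -rSeq L L₁ n → n ∈ isolatedIndices L L₁ := by
    rintro rfl
    refine ⟨hn, fun h => ?_, fun h => by linarith⟩
    simp [h] at ht
  tauto

theorem minus_congruence_iff (hn : 1 ≤ n) (ht : 2 * |t| ∈ Ioo 0 1) :
    ((∃ m : ℤ, L₁ / L * n + 1 / 2 = m) ∨ ∃ m : ℤ, L₁ / L * n + 1 / 2 + t = m) ↔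
      rSeq L L₁ n = -(1 / 2) ∨ n ∈ isolatedIndices L L₁ ∧ t = minusPhase L L₁ n := by
  obtain ⟨ht_neg, ht_pos⟩ := abs_lt.1 (show |t| < 1 / 2 by linarith [ht.2])
  rw [← rSeq_eq_neg_half_iff]
  by_cases hhalf : rSeq L L₁ n = -(1 / 2)
  · simp only [hhalf, true_or]
  by_cases h0 : rSeq L L₁ n = 0
  · obtain ⟨m, hm⟩ := rSeq_eq_zero_iff.1 h0
    have hne : ¬∃ j : ℤ, L₁ / L * n + 1 / 2 + t = j := by
      rw [exists_int_add_iff (s := 1 / 2) ⟨m + 1, by rw [hm]; push_cast; ring⟩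
        (abs_lt.2 ⟨by linarith, by linarith⟩)]
      exact ht_pos.ne
    have hn' : n ∉ isolatedIndices L L₁ := fun h => h.2.1 h0
    simp only [hhalf, hne, hn', false_and]
  · have hn' : n ∈ isolatedIndices L L₁ := ⟨hn, h0, hhalf⟩
    have hphase := two_mul_abs_minusPhase h0
    have hξ := (xiSeq_mem_Ioo hn').1
    obtain ⟨hσ_neg, hσ_pos⟩ := abs_lt.1 (show |minusPhase L L₁ n| < 1 / 2 by linarith)
    rw [exists_int_add_iff (exists_int_add_minusPhase h0) (abs_lt.2 ⟨by linarith, by linarith⟩)]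
    simp only [hn', true_and]

theorem mem_isolatedPlus_iff {A : Set ℕ} :
    z ∈ isolatedPlus L L₁ A ↔ ∃ n ∈ A,
      z = shiftedPair L n (-((n / L * G (2 * |-rSeq L L₁ n|)) ^ 2)) (-rSeq L L₁ n) := by
  refine exists_congr fun n => and_congr_right fun _ => ?_
  have hphase : uPlus L L₁ n = shiftedCnoidal L n (omegaPlus L L₁ n) (-rSeq L L₁ n) := by
    funext x
    rw [uPlus, sPlus, shiftedCnoidal]
    congr 1
    ring
  rw [two_mul_abs_neg_rSeq, hphase]
  rfl

theorem mem_isolatedMinus_iff :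
    z ∈ isolatedMinus L L₁ (isolatedIndices L L₁) ↔ ∃ n ∈ isolatedIndices L L₁,
      z = shiftedPair L n (-((n / L * G (2 * |minusPhase L L₁ n|)) ^ 2)) (minusPhase L L₁ n) := by
  refine exists_congr fun n => and_congr_right fun hn => ?_
  have hphase : uMinus L L₁ n = shiftedCnoidal L n (omegaMinus L L₁ n) (minusPhase L L₁ n) := by
    funext x
    rw [uMinus, sMinus, shiftedCnoidal, minusPhase]
    congr 1
    ring
  rw [two_mul_abs_minusPhase hn.2.1, hphase]
  rfl

theorem mem_branches_or_exists_iff (hL : 0 < L) {A B : Set ℕ} {τ : ℕ → ℝ} (hA : ∀ n ∈ A, 1 ≤ n)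
    (hB : ∀ n ∈ B, 1 ≤ n) (hτ : ∀ n ∈ B, 2 * |τ n| ∈ Ioo 0 1) :
    (z ∈ branches L A ∨ ∃ n ∈ B, z = shiftedPair L n (-((n / L * G (2 * |τ n|)) ^ 2)) (τ n)) ↔
      ∃ n : ℕ, 1 ≤ n ∧ ∃ ω < 0, ∃ t, |t| = phi (kMod L n ω) / 2 ∧
        (n ∈ A ∨ n ∈ B ∧ t = τ n) ∧ z = shiftedPair L n ω t := by
  rw [mem_branches_iff hL hA]
  constructor
  · rintro (⟨n, hn, ω, hω, t, ht, hz⟩ | ⟨n, hn, hz⟩)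
    · exact ⟨n, hA n hn, ω, hω, t, ht, Or.inl hn, hz⟩
    · obtain ⟨ω, hω, ht, hz⟩ := (eq_shiftedPair_iff hL (hB n hn) (hτ n hn)).1 hz
      exact ⟨n, hB n hn, ω, hω, τ n, ht, Or.inr ⟨hn, rfl⟩, hz⟩
  · rintro ⟨n, -, ω, hω, t, ht, hn | ⟨hn, rfl⟩, hz⟩
    · exact Or.inl ⟨n, hn, ω, hω, t, ht, hz⟩
    · exact Or.inr ⟨n, hn, (eq_shiftedPair_iff hL (hB n hn) (hτ n hn)).2 ⟨ω, hω, ht, hz⟩⟩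

theorem two_mul_abs_mem_Ioo (hL : 0 < L) (hn : 1 ≤ n) (hω : ω < 0)
    (ht : |t| = phi (kMod L n ω) / 2) : 2 * |t| ∈ Ioo 0 1 := by
  rw [ht, mul_div_cancel₀ _ two_ne_zero]
  exact phi_mem_Ioo (kMod_mem hL hn hω)

theorem solutionsPplus_eq (hL₁ : 0 < L₁) (hL : L₁ < L) :
    solutionsPplus L L₁ = branches L {n | 1 ≤ n ∧ rSeq L L₁ n = 0} ∪
      isolatedPlus L L₁ (isolatedIndices L L₁) := by
  have hL0 := hL₁.trans hL
  ext z
  rw [mem_union, mem_isolatedPlus_iff, mem_branches_or_exists_iff hL0 (fun n hn => hn.1)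
    (fun n hn => hn.1) (fun n hn => by rw [two_mul_abs_neg_rSeq]; exact xiSeq_mem_Ioo hn)]
  refine (mem_solutionsPplus_iff hL₁ hL).trans (exists_congr fun n => and_congr_right fun hn =>
    exists_congr fun ω => and_congr_right fun hω => exists_congr fun t =>
    and_congr_right fun ht => and_congr_left fun _ => ?_)
  rw [mem_ofPred_eq, and_iff_right hn]
  exact plus_congruence_iff hn (two_mul_abs_mem_Ioo hL0 hn hω ht)

theorem solutionsPminus_eq (hL₁ : 0 < L₁) (hL : L₁ < L) :
    solutionsPminus L L₁ = branches L {n | 1 ≤ n ∧ rSeq L L₁ n = -(1 / 2)} ∪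
      isolatedMinus L L₁ (isolatedIndices L L₁) := by
  have hL0 := hL₁.trans hL
  have hphase : ∀ n ∈ isolatedIndices L L₁, 2 * |minusPhase L L₁ n| ∈ Ioo 0 1 := fun n hn => by
    rw [two_mul_abs_minusPhase hn.2.1]
    obtain ⟨hpos, hlt⟩ := xiSeq_mem_Ioo hn
    exact ⟨by linarith, by linarith⟩
  ext z
  rw [mem_union, mem_isolatedMinus_iff, mem_branches_or_exists_iff hL0 (fun n hn => hn.1)
    (fun n hn => hn.1) hphase]
  refine (mem_solutionsPminus_iff hL₁ hL).trans (exists_congr fun n => and_congr_right fun hn =>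
    exists_congr fun ω => and_congr_right fun hω => exists_congr fun t =>
    and_congr_right fun ht => and_congr_left fun _ => ?_)
  rw [mem_ofPred_eq, and_iff_right hn]
  exact minus_congruence_iff hn (two_mul_abs_mem_Ioo hL0 hn hω ht)

end FractionalPart

/-! ### Rational ratios -/

section RationalRatio

variable {L L₁ : ℝ} {p q n : ℕ}

theorem rSeq_eq_zero_iff_dvd (hq : 0 < q) (hpq : Nat.Coprime p q) (hratio : L₁ / L = p / q) :
    rSeq L L₁ n = 0 ↔ q ∣ n := by
  have hq0 : (q : ℝ) ≠ 0 := by positivity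
  have hmul (m : ℤ) : (p : ℝ) / q * n = m ↔ (p * n : ℤ) = q * m := by
    rw [div_mul_eq_mul_div, div_eq_iff hq0, mul_comm (m : ℝ)]
    exact_mod_cast Iff.rfl
  rw [rSeq_eq_zero_iff, hratio]
  simp only [hmul]
  calc (∃ m : ℤ, (p * n : ℤ) = q * m) ↔ q ∣ p * n := by
        rw [← Int.natCast_dvd_natCast, Nat.cast_mul]
        rfl
    _ ↔ q ∣ n := hpq.symm.dvd_mul_left

theorem rSeq_two_mul_eq_zero_iff :
    rSeq L L₁ (2 * n) = 0 ↔ rSeq L L₁ n = 0 ∨ rSeq L L₁ n = -(1 / 2) := by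
  rw [rSeq_eq_zero_iff, rSeq_eq_zero_iff, rSeq_eq_neg_half_iff]
  push_cast
  constructor
  · rintro ⟨m, hm⟩
    obtain ⟨j, rfl | rfl⟩ := m.even_or_odd'
    · exact Or.inl ⟨j, by push_cast at hm; linarith⟩
    · exact Or.inr ⟨j + 1, by push_cast at hm ⊢; linarith⟩
  · rintro (⟨m, hm⟩ | ⟨m, hm⟩)
    · exact ⟨2 * m, by push_cast; linarith⟩
    · exact ⟨2 * m - 1, by push_cast; linarith⟩

theorem rSeq_eq_neg_half_iff_dvd (hq : 0 < q) (hpq : Nat.Coprime p q) (hratio : L₁ / L = p / q) :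
    rSeq L L₁ n = -(1 / 2) ↔ q ∣ 2 * n ∧ ¬q ∣ n := by
  have h2n := rSeq_two_mul_eq_zero_iff (L := L) (L₁ := L₁) (n := n)
  rw [rSeq_eq_zero_iff_dvd hq hpq hratio] at h2n
  rw [h2n, ← rSeq_eq_zero_iff_dvd hq hpq hratio]
  constructor
  · intro h
    exact ⟨Or.inr h, by norm_num [h]⟩
  · rintro ⟨h | h, h0⟩
    · exact absurd h h0
    · exact h

theorem mem_isolatedIndices_iff (hq : 0 < q) (hpq : Nat.Coprime p q) (hratio : L₁ / L = p / q) :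
    n ∈ isolatedIndices L L₁ ↔ 1 ≤ n ∧ ¬q ∣ 2 * n := by
  rw [← rSeq_eq_zero_iff_dvd hq hpq hratio, rSeq_two_mul_eq_zero_iff, not_or]
  rfl

theorem exists_nat_add_half_iff (hratio : L₁ / L = p / q) :
    (∃ m : ℕ, 1 ≤ m ∧ (n : ℝ) * p / q + 1 / 2 = m) ↔ rSeq L L₁ n = -(1 / 2) := by
  rw [rSeq_eq_neg_half_iff, hratio, div_mul_eq_mul_div, mul_comm (p : ℝ)]
  constructor
  · rintro ⟨m, -, hm⟩
    exact ⟨m, hm⟩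
  · rintro ⟨m, hm⟩
    have hpos : 0 < m := by
      have : (0 : ℝ) < m := hm ▸ by positivity
      exact_mod_cast this
    lift m to ℕ using hpos.le
    exact ⟨m, by exact_mod_cast hpos, hm⟩

theorem mem_multiples_natCast_iff : n ∈ multiples (q : ℝ) ↔ 1 ≤ n ∧ q ∣ n := by
  refine and_congr_right fun hn => ⟨?_, ?_⟩
  · rintro ⟨m, -, h⟩
    exact ⟨m, by rw [mul_comm]; exact_mod_cast h⟩
  · rintro ⟨m, rfl⟩
    exact ⟨m, Nat.pos_of_mul_pos_left hn, by push_cast; ring⟩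

theorem mem_oddMultiples_natCast_iff (hq : 0 < q) :
    n ∈ oddMultiples (q : ℝ) ↔ 1 ≤ n ∧ q ∣ n ∧ ¬2 * q ∣ n := by
  refine and_congr_right fun _ => ⟨?_, ?_⟩
  · rintro ⟨m, hm, h⟩
    obtain ⟨i, rfl⟩ := Nat.exists_eq_add_of_le hm
    have hn : n = q * (2 * i + 1) := by
      have : (n : ℝ) = q * (2 * i + 1) := by rw [h]; push_cast; ring
      exact_mod_cast this
    rw [hn, mul_comm 2 q, Nat.mul_dvd_mul_iff_left hq]
    exact ⟨dvd_mul_right _ _, by omega⟩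
  · rintro ⟨⟨j, rfl⟩, hj⟩
    rw [mul_comm 2 q, Nat.mul_dvd_mul_iff_left hq, ← even_iff_two_dvd, Nat.not_even_iff_odd] at hj
    obtain ⟨i, rfl⟩ := hj
    exact ⟨i + 1, by omega, by push_cast; ring⟩

theorem mem_multiples_half_iff (hq : Even q) : n ∈ multiples ((q : ℝ) / 2) ↔ 1 ≤ n ∧ q ∣ 2 * n := by
  obtain ⟨d, rfl⟩ := hq.exists_two_nsmul
  rw [smul_eq_mul, Nat.cast_mul, Nat.cast_two, mul_div_cancel_left₀ _ two_ne_zero,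
    mem_multiples_natCast_iff, Nat.mul_dvd_mul_iff_left two_pos]

theorem mem_oddMultiples_half_iff (hq0 : 0 < q) (hq : Even q) :
    n ∈ oddMultiples ((q : ℝ) / 2) ↔ 1 ≤ n ∧ q ∣ 2 * n ∧ ¬q ∣ n := by
  obtain ⟨d, rfl⟩ := hq.exists_two_nsmul
  rw [smul_eq_mul] at hq0 ⊢
  rw [Nat.cast_mul, Nat.cast_two, mul_div_cancel_left₀ _ two_ne_zero,
    mem_oddMultiples_natCast_iff (Nat.pos_of_mul_pos_left hq0), Nat.mul_dvd_mul_iff_left two_pos]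

theorem branches_empty (L : ℝ) : branches L ∅ = ∅ :=
  eq_empty_of_forall_notMem fun _ ⟨_, hn, _⟩ => hn

end RationalRatio

end DoubleBridge

theorem theorem2 (L L₁ : ℝ) (hL₁ : 0 < L₁) (hL : L₁ < L)
    (p q : ℕ) (hp : 0 < p) (hq : 0 < q) (hpq : Nat.Coprime p q)
    (hratio : L₁ / L = (p : ℝ) / (q : ℝ)) :
    solutionsPplus L L₁ =
        branches L (multiples (q : ℝ)) ∪
          isolatedPlus L L₁ {n : ℕ | 1 ≤ n ∧ n ∉ multiples (q : ℝ) ∧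
            ¬ ∃ m : ℕ, 1 ≤ m ∧ (n : ℝ) * p / q + 1 / 2 = m} ∧
      (Odd q →
        solutionsPminus L L₁ =
          isolatedMinus L L₁ {n : ℕ | 1 ≤ n ∧ n ∉ multiples (q : ℝ)}) ∧
      (Even q →
        solutionsPminus L L₁ =
          branches L (oddMultiples ((q : ℝ) / 2)) ∪
            isolatedMinus L L₁ {n : ℕ | 1 ≤ n ∧ n ∉ multiples ((q : ℝ) / 2)}) := by
  have hzero (n : ℕ) : rSeq L L₁ n = 0 ↔ q ∣ n := rSeq_eq_zero_iff_dvd hq hpq hratio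
  have hhalf (n : ℕ) : rSeq L L₁ n = -(1 / 2) ↔ q ∣ 2 * n ∧ ¬q ∣ n :=
    rSeq_eq_neg_half_iff_dvd hq hpq hratio
  have hisolated (n : ℕ) : n ∈ isolatedIndices L L₁ ↔ 1 ≤ n ∧ ¬q ∣ 2 * n :=
    mem_isolatedIndices_iff hq hpq hratio
  rw [solutionsPplus_eq hL₁ hL, solutionsPminus_eq hL₁ hL]
  simp only [exists_nat_add_half_iff hratio, mem_multiples_natCast_iff, hzero, hhalf]
  refine ⟨?_, fun hodd => ?_, fun heven => ?_⟩
  · congr 2 <;> ext n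
    · exact mem_multiples_natCast_iff.symm
    · have hdvd : q ∣ n → q ∣ 2 * n := fun h => h.mul_left 2
      rw [hisolated, mem_ofPred_eq]
      tauto
  · have hdvd (n : ℕ) : q ∣ 2 * n ↔ q ∣ n := hodd.coprime_two_right.dvd_mul_left
    simp only [hdvd, and_not_self, and_false, ofPred_false, branches_empty, empty_union]
    congr 1
    ext n
    rw [hisolated, hdvd, mem_ofPred_eq]
    tauto
  · congr 2 <;> ext n
    · exact (mem_oddMultiples_half_iff hq heven).symm
    · rw [hisolated, mem_ofPred_eq, mem_multiples_half_iff heven]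
      tauto
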